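/- Notation. Let $A$ be a separable $C^*$-algebra (not necessarily unital) whose set $T(A)$ of tracial states is nonempty and weak-$*$ compact, let $D\subseteq A$ be a nonzero $C^*$-subalgebra, and let $\mathcal U$ be a free ultrafilter on $\mathbb N$. Put $\|a\|_{2,T(A)}=\sup_{\tau\in T(A)}\tau(a^*a)^{1/2}$ for $a\in A$, and let $$A^{\mathcal U}=\ell^\infty(A)\big/\big\{(a_n)_n\in\ell^\infty(A):\ \lim_{n\to\mathcal U}\|a_n\|_{2,T(A)}=0\big\}$$ be the uniform tracial ultrapower, a $C^*$-algebra. Elements of $A$ are regarded as elements of $A^{\mathcal U}$ via constant sequences, and $A'$ denotes the set of elements commuting with all of these; for $S\subseteq A^{\mathcal U}$, $S'$ is the set of elements of $A^{\mathcal U}$ commuting with every element of $S$. Let $\kappa(D^{\mathcal U})\subseteq A^{\mathcal U}$ be the set of elements that can be represented by a bounded sequence in $D$. Let $T_{\mathcal U}(A)$ be the set of limit traces on $A^{\mathcal U}$, i.e. the functionals $[(a_n)_n]\mapsto\lim_{n\to\mathcal U}\tau_n(a_n)$ with $\tau_n\in T(A)$, and put $\|x\|_{2,T_{\mathcal U}(A)}=\sup_{\tau\in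 T_{\mathcal U}(A)}\tau(x^*x)^{1/2}$. Write $(\ast)$ for the condition that $A^{\mathcal U}$ is unital and $1_{A^{\mathcal U}}\in\kappa(D^{\mathcal U})$. In what follows $k$ ranges over the integers $k\ge 1$. * $(D\subseteq A)$ has *uniform property $\Gamma$* if $(\ast)$ holds and for every $k$ there are projections $q_1,\dots,q_k\in\kappa(D^{\mathcal U})\cap A'$ with $\sum_{i=1}^k q_i=1_{A^{\mathcal U}}$ and $\tau(q_ia)=\frac1k\tau(a)$ for all $\tau\in T_{\mathcal U}(A)$, $a\in D$, $1\le i\le k$. * $(D\subseteq A)$ has *CPoU* (complemented partitions of unity) if $(\ast)$ holds and for every $\|\cdot\|_{2,T_{\mathcal U}(A)}$-separable subset $S\subseteq A^{\mathcal U}$, every $k$, all positive $a_1,\dots,a_k\in D$ and every $\delta>0$ with $\sup_{\tau\in T(A)}\min\{\tau(a_1),\dots,\tau(a_k)\}<\delta$, there are projections $p_1,\dots,p_k\in\kappa(D^{\mathcal U})\cap S'$ with $\sum_{i=1}^kp_i=1_{A^{\mathcal U}}$ and $\tau(a_ip_i)\le\delta\,\tau(p_i)$ for all $\tau\in T_{\mathcal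 U}(A)$, $1\le i\le k$. * $(D\subseteq A)$ has *weak CPoU* if $(\ast)$ holds and for all $S$, $k$, $a_1,\dots,a_k$, $\delta$ as in the definition of CPoU and every positive contraction $q\in\kappa(D^{\mathcal U})\cap A'$ with $\tau(q)>0$ for all $\tau\in T_{\mathcal U}(A)$, there are positive contractions $e_1,\dots,e_k\in\kappa(D^{\mathcal U})\cap S'$ with $\sum_{i=1}^ke_i=1_{A^{\mathcal U}}$ and $\tau(a_ie_iq)\le\delta\,\tau(e_iq)$ for all $\tau\in T_{\mathcal U}(A)$, $1\le i\le k$. **Proposition.** If $(D\subseteq A)$ has both weak CPoU and uniform property $\Gamma$, then $(D\subseteq A)$ has CPoU. -/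

import Mathlib

open Filter Topology
open scoped ENNReal ComplexOrder

noncomputable section

namespace TracialCStar

section Traces

variable {A : Type*} [NonUnitalCStarAlgebra A]

variable (A) in
/-- The trace space `T(A)`: tracial states on `A`, i.e. positive linear functionals of norm one
with `τ (a b) = τ (b a)`, inside the dual of `A` with the weak-* topology. -/
def traceSpace : Set (WeakDual ℂ A) :=
  {τ | (∀ a : A, 0 ≤ τ (star a * a)) ∧ ‖WeakDual.toStrongDual τ‖ = 1 ∧
    ∀ a b : A, τ (a * b) = τ (b * a)}

/-- `‖a‖_{2,τ} = τ(a* a)^{1/2}` for a single functional `τ`. -/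
def norm2 (τ : WeakDual ℂ A) (a : A) : ℝ := √(τ (star a * a)).re

/-- The seminorm `‖a‖_{2,T(A)} = sup_{τ ∈ T(A)} τ(a* a)^{1/2}` (the supremum is over a set bounded
by `‖a‖`, see `norm2_le_norm`). -/
def tracialNorm (a : A) : ℝ := ⨆ τ : traceSpace A, norm2 (τ : WeakDual ℂ A) a

/-- A trace as a positive linear map, for the canonical order of the C⋆-algebra. -/
lemma exists_positiveLinearMap [PartialOrder A] [StarOrderedRing A] {τ : WeakDual ℂ A}
    (hτ : τ ∈ traceSpace A) : ∃ f : A →ₚ[ℂ] ℂ, ∀ a, f a = τ a := by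
  refine ⟨PositiveLinearMap.mk₀ (τ : A →ₗ[ℂ] ℂ) fun a ha => ?_, fun a => rfl⟩
  obtain ⟨b, rfl⟩ := CStarAlgebra.nonneg_iff_eq_star_mul_self.mp ha
  exact hτ.1 b

lemma norm2_nonneg (τ : WeakDual ℂ A) (a : A) : 0 ≤ norm2 τ a := Real.sqrt_nonneg _

lemma norm2_add_le {τ : WeakDual ℂ A} (hτ : τ ∈ traceSpace A) (a b : A) :
    norm2 τ (a + b) ≤ norm2 τ a + norm2 τ b := by
  let _ := CStarAlgebra.spectralOrder A
  have _ := CStarAlgebra.spectralOrderedRing A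
  obtain ⟨f, hf⟩ := exists_positiveLinearMap hτ
  have h := norm_add_le (f.toPreGNS a) (f.toPreGNS b)
  rw [← map_add] at h
  simp only [PositiveLinearMap.preGNS_norm_def, PositiveLinearMap.ofPreGNS_toPreGNS, hf] at h
  exact h

lemma norm2_smul {τ : WeakDual ℂ A} (c : ℂ) (a : A) :
    norm2 τ (c • a) = ‖c‖ * norm2 τ a := by
  have : star (c • a) * (c • a) = ((‖c‖ ^ 2 : ℝ) : ℂ) • (star a * a) := by
    rw [star_smul, smul_mul_smul_comm]
    congr 1
    simp [← Complex.normSq_eq_norm_sq, Complex.normSq_eq_conj_mul_self]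
  rw [norm2, this, map_smul, smul_eq_mul, Complex.re_ofReal_mul, Real.sqrt_mul (by positivity),
    Real.sqrt_sq (norm_nonneg c), norm2]

lemma norm2_mul_le {τ : WeakDual ℂ A} (hτ : τ ∈ traceSpace A) (a b : A) :
    norm2 τ (a * b) ≤ ‖a‖ * norm2 τ b := by
  let _ := CStarAlgebra.spectralOrder A
  have _ := CStarAlgebra.spectralOrderedRing A
  obtain ⟨f, hf⟩ := exists_positiveLinearMap hτ
  have h1 : ‖f.leftMulMapPreGNS a‖ ≤ ‖a‖ := by
    unfold PositiveLinearMap.leftMulMapPreGNS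
    exact LinearMap.mkContinuous_norm_le _ (norm_nonneg a) _
  have h := (f.leftMulMapPreGNS a).le_of_opNorm_le h1 (f.toPreGNS b)
  simp only [PositiveLinearMap.leftMulMapPreGNS_apply, PositiveLinearMap.preGNS_norm_def,
    PositiveLinearMap.ofPreGNS_toPreGNS, hf] at h
  exact h

lemma norm2_star {τ : WeakDual ℂ A} (hτ : τ ∈ traceSpace A) (a : A) :
    norm2 τ (star a) = norm2 τ a := by
  rw [norm2, norm2, star_star, hτ.2.2]

lemma norm_apply_le {τ : WeakDual ℂ A} (hτ : τ ∈ traceSpace A) (a : A) : ‖τ a‖ ≤ ‖a‖ := by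
  have h := (WeakDual.toStrongDual τ).le_opNorm a
  rw [hτ.2.1, one_mul] at h
  exact h

lemma norm2_le_norm {τ : WeakDual ℂ A} (hτ : τ ∈ traceSpace A) (a : A) : norm2 τ a ≤ ‖a‖ := by
  rw [norm2, Real.sqrt_le_left (norm_nonneg a), sq, ← CStarRing.norm_star_mul_self]
  exact (Complex.re_le_norm _).trans (norm_apply_le hτ _)

lemma norm_apply_le_norm2 {τ : WeakDual ℂ A} (hτ : τ ∈ traceSpace A) (a : A) :
    ‖τ a‖ ≤ norm2 τ a := by
  let _ := CStarAlgebra.spectralOrder A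
  have _ := CStarAlgebra.spectralOrderedRing A
  obtain ⟨f, hf⟩ := exists_positiveLinearMap hτ
  have hu := CStarAlgebra.increasingApproximateUnit A
  have ht : Tendsto (fun e => ‖τ (e * a)‖) (CStarAlgebra.approximateUnit A) (𝓝 ‖τ a‖) :=
    ((map_continuous τ).tendsto a).norm.comp (hu.tendsto_mul_right a)
  refine le_of_tendsto ht ?_
  filter_upwards [hu.eventually_star_eq, hu.eventually_norm] with e he hn
  have h := norm_inner_le_norm (𝕜 := ℂ) (f.toPreGNS e) (f.toPreGNS a)
  simp only [PositiveLinearMap.preGNS_inner_def, PositiveLinearMap.preGNS_norm_def,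
    PositiveLinearMap.ofPreGNS_toPreGNS, hf] at h
  rw [he] at h
  have h2 : norm2 τ e ≤ 1 := (norm2_le_norm hτ e).trans hn
  rw [norm2, he] at h2
  exact h.trans (mul_le_of_le_one_left (norm2_nonneg τ a) h2)

lemma norm2_le_tracialNorm {τ : WeakDual ℂ A} (hτ : τ ∈ traceSpace A) (a : A) :
    norm2 τ a ≤ tracialNorm a :=
  le_ciSup (f := fun σ : traceSpace A => norm2 (σ : WeakDual ℂ A) a)
    ⟨‖a‖, by rintro _ ⟨σ, rfl⟩; exact norm2_le_norm σ.2 a⟩ ⟨τ, hτ⟩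

lemma tracialNorm_nonneg (a : A) : 0 ≤ tracialNorm a :=
  Real.iSup_nonneg fun _ => norm2_nonneg _ a

lemma tracialNorm_le {a : A} {c : ℝ} (hc : 0 ≤ c) (h : ∀ τ ∈ traceSpace A, norm2 τ a ≤ c) :
    tracialNorm a ≤ c :=
  Real.iSup_le (fun τ => h τ τ.2) hc

lemma tracialNorm_le_norm (a : A) : tracialNorm a ≤ ‖a‖ :=
  tracialNorm_le (norm_nonneg a) fun _ hτ => norm2_le_norm hτ a

lemma tracialNorm_add_le (a b : A) : tracialNorm (a + b) ≤ tracialNorm a + tracialNorm b :=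
  tracialNorm_le (add_nonneg (tracialNorm_nonneg a) (tracialNorm_nonneg b)) fun _ hτ =>
    (norm2_add_le hτ a b).trans
      (add_le_add (norm2_le_tracialNorm hτ a) (norm2_le_tracialNorm hτ b))

lemma tracialNorm_smul_le (c : ℂ) (a : A) : tracialNorm (c • a) ≤ ‖c‖ * tracialNorm a :=
  tracialNorm_le (mul_nonneg (norm_nonneg c) (tracialNorm_nonneg a)) fun _ hτ => by
    rw [norm2_smul]
    exact mul_le_mul_of_nonneg_left (norm2_le_tracialNorm hτ a) (norm_nonneg c)

lemma tracialNorm_mul_le (a b : A) : tracialNorm (a * b) ≤ ‖a‖ * tracialNorm b :=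
  tracialNorm_le (mul_nonneg (norm_nonneg a) (tracialNorm_nonneg b)) fun _ hτ =>
    (norm2_mul_le hτ a b).trans
      (mul_le_mul_of_nonneg_left (norm2_le_tracialNorm hτ b) (norm_nonneg a))

lemma tracialNorm_star_le (a : A) : tracialNorm (star a) ≤ tracialNorm a :=
  tracialNorm_le (tracialNorm_nonneg a) fun _ hτ => by
    rw [norm2_star hτ]
    exact norm2_le_tracialNorm hτ a

end Traces

section Ultrapower

variable (A : Type*) [NonUnitalCStarAlgebra A] (U : Ultrafilter ℕ)

/-- The C⋆-algebra `ℓ^∞(A)` of bounded sequences in `A`, with the supremum norm. -/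
abbrev BddSeq : Type _ := lp (fun _ : ℕ => A) ∞

variable {A} in
lemma norm_coord_le (a : BddSeq A) (n : ℕ) : ‖a n‖ ≤ ‖a‖ :=
  lp.norm_apply_le_norm ENNReal.top_ne_zero a n

/-- The ideal of `ℓ^∞(A)` of the sequences with `lim_{n → U} ‖a_n‖_{2,T(A)} = 0`. -/
def nullSeq : NonUnitalStarSubalgebra ℂ (BddSeq A) where
  carrier := {a | Tendsto (fun n => tracialNorm (a n)) U (𝓝 0)}
  zero_mem' := by
    have : tracialNorm (0 : A) = 0 :=
      le_antisymm ((tracialNorm_le_norm _).trans norm_zero.le) (tracialNorm_nonneg _)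
    simp [this]
  add_mem' {a b} ha hb := by
    refine squeeze_zero (fun n => tracialNorm_nonneg _) (fun n => tracialNorm_add_le (a n) (b n)) ?_
    simpa using Tendsto.add ha hb
  mul_mem' {a b} _ hb := by
    refine squeeze_zero (fun n => tracialNorm_nonneg _)
      (fun n => (tracialNorm_mul_le (a n) (b n)).trans
        (mul_le_mul_of_nonneg_right (norm_coord_le a n) (tracialNorm_nonneg _))) ?_
    simpa using Tendsto.const_mul ‖a‖ hb
  smul_mem' c a ha := by
    refine squeeze_zero (fun n => tracialNorm_nonneg _) (fun n => tracialNorm_smul_le c (a n)) ?_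
    simpa using Tendsto.const_mul ‖c‖ ha
  star_mem' {a} ha :=
    squeeze_zero (fun n => tracialNorm_nonneg _) (fun n => tracialNorm_star_le (a n)) ha

variable {A U}

lemma mem_nullSeq {a : BddSeq A} :
    a ∈ nullSeq A U ↔ Tendsto (fun n => tracialNorm (a n)) U (𝓝 0) := Iff.rfl

lemma mul_mem_nullSeq_left (a : BddSeq A) {b : BddSeq A} (hb : b ∈ nullSeq A U) :
    a * b ∈ nullSeq A U := by
  refine squeeze_zero (fun n => tracialNorm_nonneg _)
    (fun n => (tracialNorm_mul_le (a n) (b n)).trans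
      (mul_le_mul_of_nonneg_right (norm_coord_le a n) (tracialNorm_nonneg _))) ?_
  simpa using Tendsto.const_mul ‖a‖ (mem_nullSeq.mp hb)

lemma mul_mem_nullSeq_right {a : BddSeq A} (ha : a ∈ nullSeq A U) (b : BddSeq A) :
    a * b ∈ nullSeq A U := by
  have h := mul_mem_nullSeq_left (U := U) (star b) (star_mem ha)
  rw [← star_mul] at h
  simpa using star_mem h

instance isClosed_nullSeq : IsClosed (nullSeq A U : Set (BddSeq A)) := by
  refine isClosed_of_closure_subset fun a ha => ?_
  refine Metric.tendsto_nhds.mpr fun ε hε => ?_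
  obtain ⟨b, hb, hab⟩ := Metric.mem_closure_iff.mp ha (ε / 2) (half_pos hε)
  filter_upwards [Metric.tendsto_nhds.mp (mem_nullSeq.mp hb) (ε / 2) (half_pos hε)] with n hn
  rw [Real.dist_eq, sub_zero, abs_of_nonneg (tracialNorm_nonneg _)] at hn ⊢
  have h1 : tracialNorm (a n) ≤ tracialNorm (a n - b n) + tracialNorm (b n) := by
    simpa using tracialNorm_add_le (a n - b n) (b n)
  have h2 : tracialNorm (a n - b n) ≤ ‖a - b‖ :=
    (tracialNorm_le_norm _).trans (norm_coord_le (a - b) n)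
  rw [dist_eq_norm] at hab
  linarith

variable (A U)

/-- The uniform tracial ultrapower `A^U = ℓ^∞(A) / {(a_n) : lim_{n → U} ‖a_n‖_{2,T(A)} = 0}`, with
the quotient norm. -/
def TracialUltrapower : Type _ := BddSeq A ⧸ (nullSeq A U).toSubmodule

variable {A U}

namespace TracialUltrapower

instance isClosed_toSubmodule : IsClosed ((nullSeq A U).toSubmodule : Set (BddSeq A)) :=
  isClosed_nullSeq

instance : NormedAddCommGroup (TracialUltrapower A U) :=
  inferInstanceAs (NormedAddCommGroup (BddSeq A ⧸ (nullSeq A U).toSubmodule))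

instance : NormedSpace ℂ (TracialUltrapower A U) :=
  inferInstanceAs (NormedSpace ℂ (BddSeq A ⧸ (nullSeq A U).toSubmodule))

instance : CompleteSpace (TracialUltrapower A U) :=
  inferInstanceAs (CompleteSpace (BddSeq A ⧸ (nullSeq A U).toSubmodule))

variable (A U) in
/-- The quotient map `ℓ^∞(A) → A^U`. -/
def mk : BddSeq A →ₗ[ℂ] TracialUltrapower A U := (nullSeq A U).toSubmodule.mkQ

lemma mk_surjective : Function.Surjective (mk A U) := Submodule.mkQ_surjective _

lemma mk_eq_mk {a b : BddSeq A} : mk A U a = mk A U b ↔ a - b ∈ nullSeq A U :=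
  Submodule.Quotient.eq _

lemma norm_mk_le (a : BddSeq A) : ‖mk A U a‖ ≤ ‖a‖ := Submodule.Quotient.norm_mk_le _ a

lemma exists_norm_lt (x : TracialUltrapower A U) {ε : ℝ} (hε : 0 < ε) :
    ∃ a : BddSeq A, mk A U a = x ∧ ‖a‖ < ‖x‖ + ε :=
  Submodule.Quotient.norm_mk_lt x hε

instance : Mul (TracialUltrapower A U) where
  mul := Quotient.map₂ (· * ·) fun a a' ha b b' hb => by
    have ha' := (Submodule.quotientRel_def _).mp ha
    have hb' := (Submodule.quotientRel_def _).mp hb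
    refine (Submodule.quotientRel_def _).mpr ?_
    have h : a * b - a' * b' = (a - a') * b + a' * (b - b') := by
      rw [sub_mul, mul_sub, sub_add_sub_cancel]
    rw [h]
    exact add_mem (mul_mem_nullSeq_right (U := U) ha' b) (mul_mem_nullSeq_left (U := U) a' hb')

lemma mk_mul (a b : BddSeq A) : mk A U (a * b) = mk A U a * mk A U b := rfl

instance : Star (TracialUltrapower A U) where
  star := Quotient.map star fun a b h => by
    have h' := (Submodule.quotientRel_def _).mp h
    refine (Submodule.quotientRel_def _).mpr ?_
    rw [← star_sub]
    exact star_mem (s := nullSeq A U) h'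

lemma mk_star (a : BddSeq A) : mk A U (star a) = star (mk A U a) := rfl

instance : NonUnitalNormedRing (TracialUltrapower A U) where
  left_distrib x y z := by
    obtain ⟨a, rfl⟩ := mk_surjective x
    obtain ⟨b, rfl⟩ := mk_surjective y
    obtain ⟨c, rfl⟩ := mk_surjective z
    simp only [← mk_mul, ← map_add, mul_add]
  right_distrib x y z := by
    obtain ⟨a, rfl⟩ := mk_surjective x
    obtain ⟨b, rfl⟩ := mk_surjective y
    obtain ⟨c, rfl⟩ := mk_surjective z
    simp only [← mk_mul, ← map_add, add_mul]
  zero_mul x := by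
    obtain ⟨a, rfl⟩ := mk_surjective x
    rw [← map_zero (mk A U), ← mk_mul, zero_mul]
  mul_zero x := by
    obtain ⟨a, rfl⟩ := mk_surjective x
    rw [← map_zero (mk A U), ← mk_mul, mul_zero]
  mul_assoc x y z := by
    obtain ⟨a, rfl⟩ := mk_surjective x
    obtain ⟨b, rfl⟩ := mk_surjective y
    obtain ⟨c, rfl⟩ := mk_surjective z
    simp only [← mk_mul, mul_assoc]
  dist_eq x y := dist_eq_norm_neg_add x y
  norm_mul_le x y := by
    have key : ∀ ε > 0, ‖x * y‖ ≤ (‖x‖ + ε) * (‖y‖ + ε) := fun ε hε => by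
      obtain ⟨a, rfl, ha⟩ := exists_norm_lt x hε
      obtain ⟨b, rfl, hb⟩ := exists_norm_lt y hε
      rw [← mk_mul]
      exact (norm_mk_le _).trans ((norm_mul_le a b).trans
        (mul_le_mul ha.le hb.le (norm_nonneg b) ((norm_nonneg a).trans ha.le)))
    have ht : Tendsto (fun ε : ℝ => (‖x‖ + ε) * (‖y‖ + ε)) (𝓝[>] 0) (𝓝 (‖x‖ * ‖y‖)) := by
      have : Continuous fun ε : ℝ => (‖x‖ + ε) * (‖y‖ + ε) := by fun_prop
      simpa using (this.tendsto 0).mono_left nhdsWithin_le_nhds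
    exact ge_of_tendsto ht (eventually_nhdsWithin_of_forall fun ε hε => key ε hε)

instance : StarRing (TracialUltrapower A U) where
  star_involutive x := by
    obtain ⟨a, rfl⟩ := mk_surjective x
    simp only [← mk_star, star_star]
  star_mul x y := by
    obtain ⟨a, rfl⟩ := mk_surjective x
    obtain ⟨b, rfl⟩ := mk_surjective y
    simp only [← mk_mul, ← mk_star, star_mul]
  star_add x y := by
    obtain ⟨a, rfl⟩ := mk_surjective x
    obtain ⟨b, rfl⟩ := mk_surjective y
    simp only [← mk_star, ← map_add, star_add]

instance : StarModule ℂ (TracialUltrapower A U) where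
  star_smul c x := by
    obtain ⟨a, rfl⟩ := mk_surjective x
    simp only [← mk_star, ← map_smul, star_smul]

instance : IsScalarTower ℂ (TracialUltrapower A U) (TracialUltrapower A U) where
  smul_assoc c x y := by
    obtain ⟨a, rfl⟩ := mk_surjective x
    obtain ⟨b, rfl⟩ := mk_surjective y
    simp only [smul_eq_mul, ← mk_mul, ← map_smul, smul_mul_assoc]

instance : SMulCommClass ℂ (TracialUltrapower A U) (TracialUltrapower A U) where
  smul_comm c x y := by
    obtain ⟨a, rfl⟩ := mk_surjective x
    obtain ⟨b, rfl⟩ := mk_surjective y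
    simp only [smul_eq_mul, ← mk_mul, ← map_smul, mul_smul_comm]

lemma exists_eq_star_mul_self {B : Type*} [NonUnitalCStarAlgebra B] [PartialOrder B]
    [StarOrderedRing B] {e : B} (he : 0 ≤ e) : ∃ b, e = star b * b :=
  CStarAlgebra.nonneg_iff_eq_star_mul_self.mp he

lemma norm_sub_mul_le {B : Type*} [NonUnitalCStarAlgebra B] {e b : B} (hb : e = star b * b)
    (he : ‖e‖ ≤ 1) :
    star e = e ∧ (∀ z : B, ‖z - e * z‖ ≤ ‖z‖) ∧ ∀ z : B, ‖z - z * e‖ ≤ ‖z‖ := by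
  have hse : star e = e := by rw [hb, star_mul, star_star]
  have h0 : (0 : Unitization ℂ B) ≤ (e : Unitization ℂ B) := by
    rw [hb, Unitization.inr_mul, Unitization.inr_star]
    exact star_mul_self_nonneg _
  have h1 : ‖(e : Unitization ℂ B)‖ ≤ 1 := by rwa [Unitization.norm_inr]
  have h2 := CStarAlgebra.mem_Icc_iff_norm_le_one.mpr ⟨h0, h1⟩
  have h3 : ‖(1 : Unitization ℂ B) - e‖ ≤ 1 :=
    (CStarAlgebra.mem_Icc_iff_norm_le_one.mp (Set.sub_mem_Icc_zero_iff_right.mpr h2)).2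
  have hl : ∀ z : B, ‖z - e * z‖ ≤ ‖z‖ := fun z => by
    have h : ((z - e * z : B) : Unitization ℂ B) = (1 - e) * z := by
      rw [Unitization.inr_sub, Unitization.inr_mul, sub_mul, one_mul]
    rw [← Unitization.norm_inr (𝕜 := ℂ), h, ← Unitization.norm_inr (𝕜 := ℂ) (a := z)]
    exact (norm_mul_le _ _).trans (mul_le_of_le_one_left (norm_nonneg _) h3)
  refine ⟨hse, hl, fun z => ?_⟩
  have h := hl (star z)
  rwa [← norm_star, star_sub, star_mul, star_star, hse, norm_star] at h

/-- The C⋆-identity for the quotient norm. -/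
instance : CStarRing (TracialUltrapower A U) where
  norm_mul_self_le x := by
    refine le_of_forall_pos_le_add fun ε hε => ?_
    obtain ⟨c, hc, hcn⟩ := exists_norm_lt (star x * x) (half_pos hε)
    obtain ⟨a, rfl⟩ := mk_surjective x
    rw [← mk_star, ← mk_mul, mk_eq_mk] at hc
    rw [← mk_star, ← mk_mul] at hcn ⊢
    let _ := CStarAlgebra.spectralOrder (nullSeq A U)
    have _ := CStarAlgebra.spectralOrderedRing (nullSeq A U)
    have hu := CStarAlgebra.increasingApproximateUnit (nullSeq A U)
    have ht := hu.tendsto_mul_left ⟨c - star a * a, hc⟩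
    obtain ⟨e, hn, hp, hd⟩ := (hu.eventually_norm.and (hu.eventually_nonneg.and
      (Metric.tendsto_nhds.mp ht (ε / 2) (half_pos hε)))).exists
    obtain ⟨b, hb⟩ := exists_eq_star_mul_self hp
    have hb' : (e : BddSeq A) = star (b : BddSeq A) * b := congrArg Subtype.val hb
    have hn' : ‖(e : BddSeq A)‖ ≤ 1 := hn
    have hd' : ‖(c - star a * a) * (e : BddSeq A) - (c - star a * a)‖ < ε / 2 := by
      rw [dist_eq_norm] at hd
      exact hd
    have he : (e : BddSeq A) ∈ nullSeq A U := e.2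
    obtain ⟨hse, hl, hr⟩ := norm_sub_mul_le hb' hn'
    generalize (e : BddSeq A) = e at *
    have hae : mk A U a = mk A U (a - a * e) :=
      mk_eq_mk.mpr (by simpa using mul_mem_nullSeq_left a he)
    set w := star a * a - star a * a * e with hw
    have h1 : star (a - a * e) * (a - a * e) = w - e * w := by
      simp only [hw, star_sub, star_mul, hse, sub_mul, mul_sub, mul_assoc]
      abel
    have h2 : w = (c - c * e) + ((c - star a * a) * e - (c - star a * a)) := by
      simp only [hw, sub_mul]
      abel
    calc ‖mk A U a‖ * ‖mk A U a‖ ≤ ‖a - a * e‖ * ‖a - a * e‖ := by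
          rw [hae]
          exact mul_self_le_mul_self (norm_nonneg _) (norm_mk_le _)
      _ = ‖w - e * w‖ := by rw [← CStarRing.norm_star_mul_self, h1]
      _ ≤ ‖w‖ := hl w
      _ ≤ ‖c - c * e‖ + ‖(c - star a * a) * e - (c - star a * a)‖ := by
          rw [h2]
          exact norm_add_le _ _
      _ ≤ ‖mk A U (star a * a)‖ + ε := by linarith [hr c]

instance : NonUnitalCStarAlgebra (TracialUltrapower A U) where

/-- The canonical order of the C⋆-algebra `A^U`: `x ≤ y` iff `y - x` is positive. -/
instance : PartialOrder (TracialUltrapower A U) := CStarAlgebra.spectralOrder _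

instance : StarOrderedRing (TracialUltrapower A U) := CStarAlgebra.spectralOrderedRing _

end TracialUltrapower

variable (U) in
/-- The (class of the) constant sequence with value `a`, as an element of `A^U`. -/
def constSeq (a : A) : TracialUltrapower A U :=
  TracialUltrapower.mk A U ⟨fun _ => a, memℓp_infty ⟨‖a‖, by rintro _ ⟨_, rfl⟩; exact le_rfl⟩⟩

variable (U) in
/-- The image `κ(D^U) ⊆ A^U` of the ultrapower of `D`: all elements of `A^U` that can be represented
by a bounded sequence of elements of `D`. -/
def kappaImage (D : NonUnitalStarSubalgebra ℂ A) : Set (TracialUltrapower A U) :=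
  TracialUltrapower.mk A U '' {d | ∀ n, d n ∈ D}

variable (A U) in
/-- The set `T_U(A)` of limit traces: the functionals on `A^U` induced by sequences `(τ_n)` of
traces on `A`, through `[(a_n)] ↦ lim_{n → U} τ_n(a_n)`. Every sequence of traces induces one, see
`exists_limitTrace`. -/
def limitTraces : Set (TracialUltrapower A U →ₗ[ℂ] ℂ) :=
  {φ | ∃ τ : ℕ → WeakDual ℂ A, (∀ n, τ n ∈ traceSpace A) ∧
    ∀ a : BddSeq A, Tendsto (fun n => τ n (a n)) U (𝓝 (φ (TracialUltrapower.mk A U a)))}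

lemma exists_limitTrace (τ : ℕ → WeakDual ℂ A) (hτ : ∀ n, τ n ∈ traceSpace A) :
    ∃ φ ∈ limitTraces A U,
      ∀ a : BddSeq A, Tendsto (fun n => τ n (a n)) U (𝓝 (φ (TracialUltrapower.mk A U a))) := by
  have hlim : ∀ a : BddSeq A, ∃ z : ℂ, Tendsto (fun n => τ n (a n)) U (𝓝 z) := fun a => by
    have hc := isCompact_closedBall (0 : ℂ) ‖a‖
    have hm : ∀ n, τ n (a n) ∈ Metric.closedBall (0 : ℂ) ‖a‖ := fun n => by
      rw [mem_closedBall_zero_iff]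
      exact (norm_apply_le (hτ n) _).trans (norm_coord_le a n)
    obtain ⟨z, -, hz⟩ := hc.ultrafilter_le_nhds (U.map fun n => τ n (a n))
      (le_principal_iff.mpr (mem_map.mpr (univ_mem' hm)))
    exact ⟨z, hz⟩
  choose ψ hψ using hlim
  let Ψ : BddSeq A →ₗ[ℂ] ℂ :=
    { toFun := ψ
      map_add' := fun a b => tendsto_nhds_unique (hψ (a + b)) <| by
        simpa using (hψ a).add (hψ b)
      map_smul' := fun c a => tendsto_nhds_unique (hψ (c • a)) <| by
        simpa using (hψ a).const_mul c }
  have hker : (nullSeq A U).toSubmodule ≤ LinearMap.ker Ψ := fun a ha => by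
    refine tendsto_nhds_unique (hψ a) ?_
    exact squeeze_zero_norm
      (fun n => (norm_apply_le_norm2 (hτ n) _).trans (norm2_le_tracialNorm (hτ n) _))
      (mem_nullSeq.mp ha)
  exact ⟨(nullSeq A U).toSubmodule.liftQ Ψ hker, ⟨τ, hτ, hψ⟩, hψ⟩

/-- The seminorm `‖x‖_{2,T_U(A)} = sup_{τ ∈ T_U(A)} τ(x* x)^{1/2}` on `A^U` (the supremum is over a
set bounded by `‖x‖`). -/
def limitNorm (x : TracialUltrapower A U) : ℝ :=
  ⨆ τ : limitTraces A U, √((τ : TracialUltrapower A U →ₗ[ℂ] ℂ) (star x * x)).re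

/-- `S ⊆ A^U` is separable for `‖·‖_{2,T_U(A)}`: it has a countable dense subset. -/
def IsTracialSeparable (S : Set (TracialUltrapower A U)) : Prop :=
  ∃ C ⊆ S, C.Countable ∧ ∀ x ∈ S, ∀ ε : ℝ, 0 < ε → ∃ c ∈ C, limitNorm (x - c) < ε

/-- `e` is the identity element of `M`. -/
def IsIdentity {M : Type*} [Mul M] (e : M) : Prop := ∀ x : M, e * x = x ∧ x * e = x

variable (U) in
/-- The sub-C⋆-algebra `(κ(D^U) ⊆ A^U)` is unital: `A^U` has an identity, which lies in
`κ(D^U)`. -/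
def IsUnitalInclusion (D : NonUnitalStarSubalgebra ℂ A) : Prop :=
  ∃ e ∈ kappaImage U D, IsIdentity e

/-- `p_1, …, p_k` is a partition of unity of `A^U` consisting of projections. -/
def IsProjectionPartition {k : ℕ} (p : Fin k → TracialUltrapower A U) : Prop :=
  (∀ i, IsStarProjection (p i)) ∧ IsIdentity (∑ i, p i)

variable (U) in
/-- Uniform property Γ of the sub-C⋆-algebra `(D ⊆ A)`. -/
def HasUniformGamma (D : NonUnitalStarSubalgebra ℂ A) : Prop :=
  IsUnitalInclusion U D ∧
  ∀ k : ℕ, 0 < k → ∃ q : Fin k → TracialUltrapower A U,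
    IsProjectionPartition q ∧
    (∀ i, q i ∈ kappaImage U D ∩ Set.centralizer (Set.range (constSeq U))) ∧
    ∀ τ ∈ limitTraces A U, ∀ a ∈ D, ∀ i,
      τ (q i * constSeq U a) = (1 / (k : ℂ)) * τ (constSeq U a)

variable [PartialOrder A]

variable (U) in
/-- Complemented partitions of unity (CPoU) for the sub-C⋆-algebra `(D ⊆ A)`. The values of `τ`
that are compared are real, as those of a trace at products of two positive elements. -/
def HasCPoU (D : NonUnitalStarSubalgebra ℂ A) : Prop :=
  IsUnitalInclusion U D ∧
  ∀ S : Set (TracialUltrapower A U), IsTracialSeparable S →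
  ∀ k : ℕ, 0 < k → ∀ a : Fin k → A, (∀ i, a i ∈ D ∧ 0 ≤ a i) →
  ∀ δ : ℝ, 0 < δ →
    (⨆ τ : traceSpace A, ⨅ i, ((τ : WeakDual ℂ A) (a i)).re) < δ →
    ∃ p : Fin k → TracialUltrapower A U,
      IsProjectionPartition p ∧
      (∀ i, p i ∈ kappaImage U D ∩ Set.centralizer S) ∧
      ∀ τ ∈ limitTraces A U, ∀ i, (τ (constSeq U (a i) * p i)).re ≤ δ * (τ (p i)).re

variable (U) in
/-- Weak CPoU for the sub-C⋆-algebra `(D ⊆ A)`. The values of `τ` that are compared are real: `q`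
commutes with `A`, so `τ (a e q) = τ ((q a) e)` with `q a` and `e` positive. -/
def HasWeakCPoU (D : NonUnitalStarSubalgebra ℂ A) : Prop :=
  IsUnitalInclusion U D ∧
  ∀ S : Set (TracialUltrapower A U), IsTracialSeparable S →
  ∀ k : ℕ, 0 < k → ∀ a : Fin k → A, (∀ i, a i ∈ D ∧ 0 ≤ a i) →
  ∀ δ : ℝ, 0 < δ →
    (⨆ τ : traceSpace A, ⨅ i, ((τ : WeakDual ℂ A) (a i)).re) < δ →
  ∀ q ∈ kappaImage U D ∩ Set.centralizer (Set.range (constSeq U)),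
    0 ≤ q → ‖q‖ ≤ 1 → (∀ τ ∈ limitTraces A U, 0 < (τ q).re) →
    ∃ e : Fin k → TracialUltrapower A U,
      (∀ i, 0 ≤ e i ∧ ‖e i‖ ≤ 1 ∧ e i ∈ kappaImage U D ∩ Set.centralizer S) ∧
      IsIdentity (∑ i, e i) ∧
      ∀ τ ∈ limitTraces A U, ∀ i,
        (τ (constSeq U (a i) * e i * q)).re ≤ δ * (τ (e i * q)).re

end Ultrapower

end TracialCStar

end

/-! Weak CPoU already gives positive contractions with the right trace estimates, even relative to a
weight q. What is missing is that they be orthogonal projections, and uniform property Γ repairs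
this at the price of a factor 1/k in trace. The loss is recovered by iteration.

Suppose that orthogonal projections p_i satisfy the estimates and that their sum has constant trace
α < 1. The defect q = 1 - ∑ p_i has constant trace 1 - α > 0, so it is an admissible weight, and
weak CPoU gives e_i relative to q. Tracial projectionisation (`HasUniformGamma.exists_projection`)
turns each e_i into a projection r_i with the same traces against q and against the q a_j. Property
Γ (`HasUniformGamma.exists_projections`) supplies orthogonal projections g_i that commute with
everything in sight and divide the relevant traces by k. Then p_i + g_i r_i q again satisfies all
the conditions, now with total trace α + (1 - α)/k (`IsPartialCPoU.exists_enlarge`). After N rounds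
the defect has trace (1 - 1/k)^N.

Saturation (`exists_seq_tracial`) replaces these approximate solutions by an exact one. There the
defect is a projection of trace zero under every limit trace, hence zero by faithfulness
(`eq_zero_of_forall_limitTrace`). Separable sets reduce to countable ones because commutators with a
projection are bounded in the tracial 2-norm. -/

namespace TracialCStar

/-! ### Limit traces on the ultrapower. -/

section LimitTraces

variable {A : Type*} [NonUnitalCStarAlgebra A] {U : Ultrafilter ℕ}

namespace TracialUltrapower

variable (A U) in
/-- The quotient map `ℓ^∞(A) → A^U` as a ⋆-homomorphism. -/
noncomputable def mkHom : BddSeq A →⋆ₙₐ[ℂ] TracialUltrapower A U where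
  toFun := mk A U
  map_smul' c a := map_smul (mk A U) c a
  map_zero' := map_zero (mk A U)
  map_add' := map_add (mk A U)
  map_mul' := mk_mul
  map_star' := mk_star

lemma continuous_mk : Continuous (mk A U) :=
  AddMonoidHomClass.continuous_of_bound (mk A U) 1 fun a => by simpa using norm_mk_le a

lemma mk_eq_zero {a : BddSeq A} : mk A U a = 0 ↔ a ∈ nullSeq A U := by
  rw [← map_zero (mk A U), mk_eq_mk, sub_zero]

end TracialUltrapower

open TracialUltrapower

/-- A bounded family of elements, as an element of `ℓ^∞(A)`. -/
def bddSeq (a : ℕ → A) (C : ℝ) (h : ∀ n, ‖a n‖ ≤ C) : BddSeq A :=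
  ⟨a, memℓp_infty ⟨C, by rintro _ ⟨n, rfl⟩; exact h n⟩⟩

lemma norm_trace_star_mul_le {τ : WeakDual ℂ A} (hτ : τ ∈ traceSpace A) (a b : A) :
    ‖τ (star a * b)‖ ≤ norm2 τ a * norm2 τ b := by
  let _ := CStarAlgebra.spectralOrder A
  have _ := CStarAlgebra.spectralOrderedRing A
  obtain ⟨f, hf⟩ := exists_positiveLinearMap hτ
  have h := norm_inner_le_norm (𝕜 := ℂ) (f.toPreGNS a) (f.toPreGNS b)
  simp only [PositiveLinearMap.preGNS_inner_def, PositiveLinearMap.preGNS_norm_def,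
    PositiveLinearMap.ofPreGNS_toPreGNS, hf] at h
  exact h

variable {φ : TracialUltrapower A U →ₗ[ℂ] ℂ}

lemma limitTrace_mul_comm (hφ : φ ∈ limitTraces A U) (x y : TracialUltrapower A U) :
    φ (x * y) = φ (y * x) := by
  obtain ⟨τ, hτ, h⟩ := hφ
  obtain ⟨a, rfl⟩ := mk_surjective x
  obtain ⟨b, rfl⟩ := mk_surjective y
  refine tendsto_nhds_unique (h (a * b)) ((h (b * a)).congr fun n => ?_)
  exact (hτ n).2.2 _ _

lemma limitTrace_star_mul_self_nonneg (hφ : φ ∈ limitTraces A U) (x : TracialUltrapower A U) :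
    0 ≤ φ (star x * x) := by
  obtain ⟨τ, hτ, h⟩ := hφ
  obtain ⟨a, rfl⟩ := mk_surjective x
  exact ge_of_tendsto (h (star a * a)) (Eventually.of_forall fun n => (hτ n).1 _)

lemma limitTrace_nonneg (hφ : φ ∈ limitTraces A U) {x : TracialUltrapower A U} (hx : 0 ≤ x) :
    0 ≤ φ x := by
  obtain ⟨y, rfl⟩ := CStarAlgebra.nonneg_iff_eq_star_mul_self.mp hx
  exact limitTrace_star_mul_self_nonneg hφ y

lemma norm_limitTrace_star_mul_sq_le (hφ : φ ∈ limitTraces A U) (x y : TracialUltrapower A U) :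
    ‖φ (star x * y)‖ ^ 2 ≤ (φ (star x * x)).re * (φ (star y * y)).re := by
  obtain ⟨τ, hτ, h⟩ := hφ
  obtain ⟨a, rfl⟩ := mk_surjective x
  obtain ⟨b, rfl⟩ := mk_surjective y
  refine le_of_tendsto_of_tendsto ((h (star a * b)).norm.pow 2)
    (((Complex.continuous_re.tendsto _).comp (h (star a * a))).mul
      ((Complex.continuous_re.tendsto _).comp (h (star b * b)))) (Eventually.of_forall fun n => ?_)
  have h1 := norm_trace_star_mul_le (hτ n) (a n) (b n)
  refine (pow_le_pow_left₀ (norm_nonneg _) h1 2).trans_eq ?_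
  have h2 : ∀ c : A, 0 ≤ (τ n (star c * c)).re := fun c => (Complex.le_def.mp ((hτ n).1 c)).1
  rw [mul_pow, norm2, norm2, Real.sq_sqrt (h2 _), Real.sq_sqrt (h2 _)]
  rfl

/-- The bound holds in each coordinate by an approximate unit of A, so it requires no identity in
`A^U`. -/
lemma norm_limitTrace_sq_le (hφ : φ ∈ limitTraces A U) (x : TracialUltrapower A U) :
    ‖φ x‖ ^ 2 ≤ (φ (star x * x)).re := by
  obtain ⟨τ, hτ, h⟩ := hφ
  obtain ⟨a, rfl⟩ := mk_surjective x
  refine le_of_tendsto_of_tendsto ((h a).norm.pow 2)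
    ((Complex.continuous_re.tendsto _).comp (h (star a * a))) (Eventually.of_forall fun n => ?_)
  refine (pow_le_pow_left₀ (norm_nonneg _) (norm_apply_le_norm2 (hτ n) (a n)) 2).trans_eq ?_
  rw [norm2, Real.sq_sqrt (Complex.le_def.mp ((hτ n).1 _)).1]
  rfl

lemma norm_limitTrace_le (hφ : φ ∈ limitTraces A U) (x : TracialUltrapower A U) :
    ‖φ x‖ ≤ ‖x‖ := by
  refine le_of_forall_pos_le_add fun ε hε => ?_
  obtain ⟨τ, hτ, h⟩ := hφ
  obtain ⟨a, rfl, ha⟩ := exists_norm_lt x hε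
  refine le_of_tendsto (h a).norm (Eventually.of_forall fun n => ?_)
  exact (norm_apply_le (hτ n) _).trans ((norm_coord_le a n).trans ha.le)

lemma IsIdentity.isStarProjection {R : Type*} [NonUnitalRing R] [StarRing R] {u : R}
    (hu : IsIdentity u) : IsStarProjection u := by
  refine ⟨(hu u).1, ?_⟩
  have h1 := (hu (star u)).2
  have h2 := congrArg star h1
  rw [star_mul, star_star, h1] at h2
  exact h2

/-- A limit trace takes the value one at the identity of `A^U`. -/
lemma limitTrace_identity (hU : (U : Filter ℕ) ≤ cofinite) (hφ : φ ∈ limitTraces A U)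
    {u : TracialUltrapower A U} (hu : IsIdentity u) : φ u = 1 := by
  have hφ' := hφ
  obtain ⟨τ, hτ, h⟩ := hφ
  have hproj : IsStarProjection u := hu.isStarProjection
  have hus : star u = u := hproj.isSelfAdjoint
  -- A may lack a unit, so norm one of a trace is witnessed only by nearly norming contractions. As
  -- U is free, the error 1/(n+1) vanishes in the limit.
  have key : ∀ n : ℕ, ∃ a : A, ‖a‖ ≤ 1 ∧ 1 - 1 / ((n : ℝ) + 1) ≤ ‖τ n a‖ := fun n => by
    have hlt : 1 - 1 / ((n : ℝ) + 1) < ‖WeakDual.toStrongDual (τ n)‖ := by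
      rw [(hτ n).2.1]
      have : 0 < 1 / ((n : ℝ) + 1) := by positivity
      linarith
    obtain ⟨a, ha, hlt'⟩ := ContinuousLinearMap.exists_lt_apply_of_lt_opNorm _ hlt
    exact ⟨a, ha.le, hlt'.le⟩
  choose a ha ha' using key
  set b := bddSeq a 1 ha
  obtain ⟨v, rfl⟩ := mk_surjective u
  have h1 : 1 ≤ ‖φ (mk A U b)‖ := by
    refine le_of_tendsto_of_tendsto (b := (U : Filter ℕ))
      (f := fun n : ℕ => 1 - 1 / ((n : ℝ) + 1)) ?_ (h b).norm (Eventually.of_forall ha')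
    have := (tendsto_one_div_add_atTop_nhds_zero_nat (𝕜 := ℝ)).mono_left
      (hU.trans_eq Nat.cofinite_eq_atTop)
    simpa using this.const_sub 1
  have h2 : (φ (star (mk A U b) * mk A U b)).re ≤ 1 := by
    refine (Complex.re_le_norm _).trans ((norm_limitTrace_le hφ' _).trans ?_)
    rw [CStarRing.norm_star_mul_self]
    have hb : ‖b‖ ≤ 1 := lp.norm_le_of_forall_le zero_le_one ha
    exact mul_le_one₀ ((norm_mk_le b).trans hb) (norm_nonneg _) ((norm_mk_le b).trans hb)
  -- Cauchy–Schwarz against the identity: 1 ≤ |φ(b)|² ≤ φ(u) φ(b* b) ≤ φ(u).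
  have h3 := norm_limitTrace_star_mul_sq_le hφ' (mk A U v) (mk A U b)
  rw [hus, (hu _).1, (hu _).1] at h3
  have h4 : 0 ≤ φ (mk A U v) := limitTrace_nonneg hφ' hproj.nonneg
  have h5 : (φ (mk A U v)).re ≤ 1 :=
    (Complex.re_le_norm _).trans ((norm_limitTrace_le hφ' _).trans (hproj.norm_le))
  have h6 := Complex.le_def.mp h4
  have h7 : 1 ≤ (φ (mk A U v)).re := by
    have h8 : 1 ≤ ‖φ (mk A U b)‖ ^ 2 := one_le_pow₀ h1
    exact (h8.trans h3).trans (mul_le_of_le_one_right h6.1 h2)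
  exact Complex.ext (le_antisymm h5 h7) (by simpa using h6.2.symm)

/-- A condition that holds for all limit traces holds approximately and uniformly on `T(A)`, for
`U`-many coordinates. -/
lemma eventually_forall_trace_lt (hT : (traceSpace A).Nonempty) {F : ℂ → ℝ} (hF : Continuous F)
    {a : BddSeq A} {c ε : ℝ} (h : ∀ φ ∈ limitTraces A U, F (φ (mk A U a)) ≤ c) (hc : c < ε) :
    ∀ᶠ n in U, ∀ τ ∈ traceSpace A, F (τ (a n)) < ε := by
  by_contra hcon
  rw [← Ultrafilter.eventually_not] at hcon
  -- Choose a violating trace wherever one exists and any trace elsewhere. For an ultrafilter,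
  -- failure of the claim means violation at U-many coordinates, so the limit of these traces
  -- contradicts `h`.
  have key : ∀ n, ∃ τ ∈ traceSpace A,
      (¬ ∀ τ ∈ traceSpace A, F (τ (a n)) < ε) → ε ≤ F (τ (a n)) := fun n => by
    by_cases hn : ∀ τ ∈ traceSpace A, F (τ (a n)) < ε
    · exact ⟨hT.some, hT.some_mem, fun h => absurd hn h⟩
    · push Not at hn
      obtain ⟨τ, hτ, hle⟩ := hn
      exact ⟨τ, hτ, fun _ => hle⟩
  choose τ hτ hτ' using key
  obtain ⟨φ, hφ, hlim⟩ := exists_limitTrace (U := U) τ hτ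
  have h1 : ε ≤ F (φ (mk A U a)) :=
    ge_of_tendsto ((hF.tendsto _).comp (hlim a)) (hcon.mono fun n hn => hτ' n hn)
  exact absurd (h φ hφ) (by linarith)

lemma tracialNorm_le_of_forall {a : A} {ε : ℝ} (hε : 0 < ε)
    (h : ∀ τ ∈ traceSpace A, (τ (star a * a)).re < ε ^ 2) : tracialNorm a ≤ ε :=
  tracialNorm_le hε.le fun τ hτ => Real.sqrt_le_iff.mpr ⟨hε.le, (h τ hτ).le⟩

lemma eventually_tracialNorm_lt (hT : (traceSpace A).Nonempty) {a : BddSeq A} {c ε : ℝ}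
    (hε : 0 < ε) (h : ∀ φ ∈ limitTraces A U, (φ (star (mk A U a) * mk A U a)).re ≤ c)
    (hc : c < ε ^ 2) : ∀ᶠ n in U, tracialNorm (a n) < ε := by
  -- The supremum over the traces turns a strict bound into a weak one; the intermediate δ restores
  -- strictness.
  obtain ⟨δ, hδ, hδε⟩ : ∃ δ, c < δ ^ 2 ∧ 0 < δ ∧ δ < ε := by
    have : ∀ᶠ δ in 𝓝[<] ε, c < δ ^ 2 :=
      ((continuous_pow 2).tendsto ε).mono_left nhdsWithin_le_nhds |>.eventually (lt_mem_nhds hc)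
    obtain ⟨δ, h1, h2⟩ := (this.and (Ioo_mem_nhdsLT hε)).exists
    exact ⟨δ, h1, h2.1, h2.2⟩
  filter_upwards [eventually_forall_trace_lt (a := star a * a) hT Complex.continuous_re h hδ]
    with n hn
  exact (tracialNorm_le_of_forall hδε.1 hn).trans_lt hδε.2

/-- The family of limit traces is faithful on `A^U`. -/
lemma eq_zero_of_forall_limitTrace (hT : (traceSpace A).Nonempty) {x : TracialUltrapower A U}
    (h : ∀ φ ∈ limitTraces A U, (φ (star x * x)).re ≤ 0) : x = 0 := by
  obtain ⟨a, rfl⟩ := mk_surjective x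
  rw [mk_eq_zero, mem_nullSeq, Metric.tendsto_nhds]
  intro ε hε
  filter_upwards [eventually_tracialNorm_lt hT hε h (by positivity)] with n hn
  rwa [Real.dist_eq, sub_zero, abs_of_nonneg (tracialNorm_nonneg _)]

lemma eventually_tracialNorm_lt_of_mk_eq_zero {a : BddSeq A} (h : mk A U a = 0) {ε : ℝ}
    (hε : 0 < ε) : ∀ᶠ n in U, tracialNorm (a n) < ε :=
  (mem_nullSeq.mp (mk_eq_zero.mp h)).eventually (gt_mem_nhds hε)

lemma mk_eq_zero_of_eventually {a : BddSeq A}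
    (h : ∀ ε : ℝ, 0 < ε → ∀ᶠ n in U, tracialNorm (a n) < ε) : mk A U a = 0 := by
  rw [mk_eq_zero, mem_nullSeq, Metric.tendsto_nhds]
  intro ε hε
  filter_upwards [h ε hε] with n hn
  rwa [Real.dist_eq, sub_zero, abs_of_nonneg (tracialNorm_nonneg _)]

/-- The way back from `eventually_forall_trace_lt`: estimates obtained coordinatewise by saturation
become exact for limit traces. -/
lemma limitTrace_le_of_eventually (hφ : φ ∈ limitTraces A U) {F : ℂ → ℝ} (hF : Continuous F)
    {a : BddSeq A} (h : ∀ ε : ℝ, 0 < ε → ∀ᶠ n in U, ∀ τ ∈ traceSpace A, F (τ (a n)) < ε) :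
    F (φ (mk A U a)) ≤ 0 := by
  obtain ⟨τ, hτ, hlim⟩ := hφ
  refine le_of_forall_pos_le_add fun ε hε => ?_
  rw [zero_add]
  exact le_of_tendsto ((hF.tendsto _).comp (hlim a)) ((h ε hε).mono fun n hn => (hn _ (hτ n)).le)

end LimitTraces

end TracialCStar

namespace TracialCStar

open TracialUltrapower

/-! ### Lifting positive contractions from κ(D^U). -/

section Subalgebra

variable {A : Type*} [NonUnitalCStarAlgebra A] {U : Ultrafilter ℕ}

/-- The bounded sequences with values in the subalgebra `D`. -/
def seqSubalgebra (D : NonUnitalStarSubalgebra ℂ A) : NonUnitalStarSubalgebra ℂ (BddSeq A) where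
  carrier := {d | ∀ n, d n ∈ D}
  zero_mem' _ := zero_mem D
  add_mem' ha hb n := add_mem (ha n) (hb n)
  mul_mem' ha hb n := mul_mem (ha n) (hb n)
  smul_mem' c _ ha n := D.smul_mem' c (ha n)
  star_mem' ha n := star_mem (ha n)

variable (U) in
/-- `κ(D^U)` as a ⋆-subalgebra of `A^U`. -/
noncomputable def kappa (D : NonUnitalStarSubalgebra ℂ A) :
    NonUnitalStarSubalgebra ℂ (TracialUltrapower A U) :=
  (seqSubalgebra D).map (mkHom A U)

variable {D : NonUnitalStarSubalgebra ℂ A}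

lemma constSeq_mem_kappa {a : A} (ha : a ∈ D) : constSeq U a ∈ kappa U D :=
  ⟨_, fun _ => ha, rfl⟩

lemma isClosed_seqSubalgebra (hD : IsClosed (D : Set A)) :
    IsClosed (seqSubalgebra D : Set (BddSeq A)) := by
  have : (seqSubalgebra D : Set (BddSeq A)) = ⋂ n, (fun d : BddSeq A => d n) ⁻¹' D := by
    ext d
    simp only [Set.mem_iInter, Set.mem_preimage, SetLike.mem_coe]
    rfl
  rw [this]
  refine isClosed_iInter fun n => hD.preimage ?_
  refine LipschitzWith.continuous (K := 1) (LipschitzWith.of_dist_le_mul fun a b => ?_)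
  simpa [dist_eq_norm] using norm_coord_le (a - b) n

variable (D) in
/-- The self-adjoint contractions of `D`. -/
def SAContraction : Type _ := {d : A // d ∈ D ∧ star d = d ∧ ‖d‖ ≤ 1}

/-- The element of `ℓ^∞(A)` given by a sequence of self-adjoint contractions. -/
def SAContraction.seq (x : ℕ → SAContraction D) : BddSeq A :=
  bddSeq (fun n => (x n).1) 1 fun n => (x n).2.2.2

lemma SAContraction.mk_seq_mem (x : ℕ → SAContraction D) :
    mk A U (SAContraction.seq x) ∈ kappa U D :=
  ⟨_, fun n => (x n).2.1, rfl⟩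

lemma SAContraction.star_mk_seq (x : ℕ → SAContraction D) :
    star (mk A U (SAContraction.seq x)) = mk A U (SAContraction.seq x) := by
  rw [← mk_star]
  congr 1
  ext n
  exact (x n).2.2.1

/-- Positive contractions in the range of a ⋆-homomorphism lift to self-adjoint contractions. -/
lemma exists_selfAdjoint_contraction_lift {B M : Type*} [NonUnitalCStarAlgebra B]
    [NonUnitalCStarAlgebra M] [PartialOrder M] [StarOrderedRing M] (ψ : B →⋆ₙₐ[ℂ] M)
    (hψ : Continuous ψ) (d : B) (h0 : 0 ≤ ψ d) (h1 : ‖ψ d‖ ≤ 1) :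
    ∃ b : B, star b = b ∧ ‖b‖ ≤ 1 ∧ ψ b = ψ d := by
  let d1 : B := (1 / 2 : ℂ) • (d + star d)
  have hxs : star (ψ d) = ψ d := (IsSelfAdjoint.of_nonneg h0).star_eq
  have hd1 : ψ d1 = ψ d := by
    rw [map_smul, map_add, map_star, hxs, ← two_smul ℂ, smul_smul]
    norm_num
  have hsa : IsSelfAdjoint d1 := by
    rw [IsSelfAdjoint, star_smul, star_add, star_star, add_comm]
    simp [d1]
  have hxsa : IsSelfAdjoint (ψ d1) := by rw [hd1]; exact hxs
  -- Truncating the real part of the lift forces norm at most one. Since f is the identity on [0,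
  -- 1], which contains the quasispectrum of the image, the image is unchanged.
  let f : ℝ → ℝ := fun t => max 0 (min t 1)
  have hf : Continuous f := by fun_prop
  have hf0 : f 0 = 0 := by simp [f]
  refine ⟨cfcₙ f d1, (cfcₙ_predicate f d1).star_eq, norm_cfcₙ_le fun t _ => ?_, ?_⟩
  · rw [Real.norm_of_nonneg (le_max_left _ _)]
    exact max_le zero_le_one (min_le_right _ _)
  · rw [NonUnitalStarAlgHom.map_cfcₙ ψ f d1 hf.continuousOn hf0 hψ hsa hxsa, hd1]
    rw [hd1] at hxsa
    refine (cfcₙ_congr (g := id) fun t ht => ?_).trans (cfcₙ_id ℝ (ψ d) hxsa)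
    have ht0 : 0 ≤ t := quasispectrum_nonneg_of_nonneg _ h0 t ht
    have ht1 : t ≤ 1 := (le_abs_self t).trans
      ((NonUnitalIsometricContinuousFunctionalCalculus.norm_quasispectrum_le (𝕜 := ℝ) (ψ d) ht hxsa).trans h1)
    simp [f, ht0, ht1]

/-- Positive contractions in `κ(D^U)` lift to sequences of self-adjoint contractions in `D`. -/
lemma exists_saContraction_lift (hD : IsClosed (D : Set A)) {x : TracialUltrapower A U}
    (hx : x ∈ kappa U D) (h0 : 0 ≤ x) (h1 : ‖x‖ ≤ 1) :
    ∃ d : ℕ → SAContraction D, mk A U (SAContraction.seq d) = x := by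
  obtain ⟨d, hd, rfl⟩ := hx
  have hcl : IsClosed (seqSubalgebra D : Set (BddSeq A)) := isClosed_seqSubalgebra hD
  obtain ⟨b, hbs, hbn, hb⟩ := exists_selfAdjoint_contraction_lift
    ((mkHom A U).comp (NonUnitalStarSubalgebraClass.subtype (seqSubalgebra D)))
    (continuous_mk.comp continuous_subtype_val) ⟨d, hd⟩ h0 h1
  refine ⟨fun n => ⟨b.1 n, b.2 n, ?_, (norm_coord_le b.1 n).trans hbn⟩, hb⟩
  exact congrArg (fun z : seqSubalgebra D => z.1 n) hbs

end Subalgebra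

/-! ### Countable saturation. -/

section Saturation

/-- Countable saturation: if any finitely many of the conditions `P j` can be satisfied at `U`-many
coordinates, then one sequence satisfies each of them at `U`-many coordinates. -/
lemma exists_seq_eventually {ι X : Type*} [Countable ι] {U : Ultrafilter ℕ}
    (hU : (U : Filter ℕ) ≤ cofinite) (P : ι → ℕ → X → Prop)
    (h : ∀ s : Finset ι, ∀ᶠ n in U, ∃ x, ∀ j ∈ s, P j n x) :
    ∃ x : ℕ → X, ∀ j, ∀ᶠ n in U, P j n (x n) := by
  classical
  obtain ⟨e, he⟩ := exists_injective_nat ι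
  let s : ℕ → Finset ι := fun m => (Finset.range m).preimage e he.injOn
  have hs : ∀ m j, j ∈ s m ↔ e j < m := fun m j => by simp [s]
  -- At coordinate n, solve the longest initial segment of conditions, of length at most n, that is
  -- solvable there.
  let G : ℕ → ℕ → Prop := fun n m => ∃ x, ∀ j ∈ s m, P j n x
  obtain ⟨n₀, x₀, -⟩ := (h ∅).exists
  have key : ∀ n, ∃ x, G n (Nat.findGreatest (G n) n) → ∀ j ∈ s (Nat.findGreatest (G n) n), P j n x :=
    fun n => by
      by_cases hG : G n (Nat.findGreatest (G n) n)
      · exact ⟨hG.choose, fun _ => hG.choose_spec⟩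
      · exact ⟨x₀, fun h => absurd h hG⟩
  choose x hx using key
  refine ⟨x, fun j => ?_⟩
  -- The search at coordinate n stops at n, so n must exceed `e j`; freeness of U provides this.
  have hlarge : ∀ᶠ n in U, e j + 1 ≤ n :=
    (hU.trans_eq Nat.cofinite_eq_atTop) (eventually_ge_atTop _)
  filter_upwards [h (s (e j + 1)), hlarge] with n hn hle
  refine hx n (Nat.findGreatest_spec hle hn) j ((hs _ _).mpr ?_)
  exact Nat.lt_of_succ_le (Nat.le_findGreatest hle hn)

end Saturation

end TracialCStar

namespace TracialCStar

open TracialUltrapower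

/-! ### Property Γ relative to countable subsets of the ultrapower. -/

section GammaSaturation

variable {A : Type*} [NonUnitalCStarAlgebra A] {U : Ultrafilter ℕ}

/-- Countable saturation for conditions in the uniform 2-norm (`G`) and conditions that are uniform
over the traces (`L`, `F`). -/
lemma exists_seq_tracial {ι κ X : Type*} [Countable ι] [Countable κ]
    (hU : (U : Filter ℕ) ≤ cofinite) (G : ι → ℕ → X → A) (L : κ → ℕ → X → A) (F : κ → ℂ → ℝ)
    (h : ∀ ε : ℝ, 0 < ε → ∀ (s : Finset ι) (t : Finset κ), ∀ᶠ n in U, ∃ x,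
      (∀ i ∈ s, tracialNorm (G i n x) < ε) ∧
      ∀ j ∈ t, ∀ τ ∈ traceSpace A, F j ((τ : WeakDual ℂ A) (L j n x)) < ε) :
    ∃ x : ℕ → X,
      (∀ i, ∀ ε : ℝ, 0 < ε → ∀ᶠ n in U, tracialNorm (G i n (x n)) < ε) ∧
      ∀ j, ∀ ε : ℝ, 0 < ε → ∀ᶠ n in U, ∀ τ ∈ traceSpace A,
        F j ((τ : WeakDual ℂ A) (L j n (x n))) < ε := by
  classical
  -- Each condition is repeated with every tolerance 1/(m+1), which keeps the family countable.
  let P : (ι ⊕ κ) × ℕ → ℕ → X → Prop := fun p n x =>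
    Sum.elim (fun i => tracialNorm (G i n x) < 1 / ((p.2 : ℝ) + 1))
      (fun j => ∀ τ ∈ traceSpace A, F j ((τ : WeakDual ℂ A) (L j n x)) < 1 / ((p.2 : ℝ) + 1)) p.1
  obtain ⟨x, hx⟩ := exists_seq_eventually hU P fun s => by
    let N := s.sup Prod.snd
    filter_upwards [h (1 / ((N : ℝ) + 1)) (by positivity) (s.image Prod.fst).toLeft
      (s.image Prod.fst).toRight] with n ⟨x, h1, h2⟩
    refine ⟨x, ?_⟩
    have hle : ∀ p ∈ s, 1 / ((N : ℝ) + 1) ≤ 1 / ((p.2 : ℝ) + 1) := fun p hp => by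
      have : p.2 ≤ N := Finset.le_sup (f := Prod.snd) hp
      gcongr
    rintro ⟨i | j, m⟩ hp
    · exact (h1 i (Finset.mem_toLeft.mpr (Finset.mem_image_of_mem Prod.fst hp))).trans_le
        (hle _ hp)
    · exact fun τ hτ =>
        (h2 j (Finset.mem_toRight.mpr (Finset.mem_image_of_mem Prod.fst hp)) τ hτ).trans_le
          (hle _ hp)
  refine ⟨x, fun i ε hε => ?_, fun j ε hε => ?_⟩
  · obtain ⟨m, hm⟩ := exists_nat_one_div_lt hε
    exact (hx (Sum.inl i, m)).mono fun n hn => lt_trans hn hm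
  · obtain ⟨m, hm⟩ := exists_nat_one_div_lt hε
    exact (hx (Sum.inr j, m)).mono fun n hn τ hτ => (hn τ hτ).trans hm

/-- Projections that add up to the identity are mutually orthogonal. -/
lemma IsProjectionPartition.mul_eq_zero {k : ℕ} {q : Fin k → TracialUltrapower A U}
    (hq : IsProjectionPartition q) {i j : Fin k} (hij : i ≠ j) : q i * q j = 0 := by
  have hs : ∀ i, star (q i) = q i := fun i => (hq.1 i).isSelfAdjoint
  have hi : ∀ i, q i * q i = q i := fun i => (hq.1 i).isIdempotentElem
  -- Compress the identity by q_j and cancel the term l = j: the remaining positive terms add up to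
  -- zero, so each vanishes, and q_j q_i q_j is the square of q_i q_j.
  have h1 : ∑ l, q j * q l * q j = q j := by
    rw [← Finset.sum_mul, ← Finset.mul_sum, (hq.2 _).2, hi]
  rw [← Finset.add_sum_erase _ _ (Finset.mem_univ j), hi, hi, add_eq_left] at h1
  have hnn : ∀ l ∈ Finset.univ.erase j, 0 ≤ q j * q l * q j := fun l _ =>
    (hq.1 j).isSelfAdjoint.conjugate_nonneg (hq.1 l).nonneg
  have h2 := (Finset.sum_eq_zero_iff_of_nonneg hnn).mp h1 i (by simp [hij])
  rw [← CStarRing.star_mul_self_eq_zero_iff, star_mul, hs, hs, mul_assoc, ← mul_assoc (q i), hi,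
    ← mul_assoc, h2]

lemma mem_centralizer_of_eventually {a c : BddSeq A}
    (h : ∀ ε : ℝ, 0 < ε → ∀ᶠ n in U, tracialNorm (a n * c n - c n * a n) < ε) :
    mk A U c * mk A U a = mk A U a * mk A U c := by
  have : mk A U (a * c - c * a) = 0 := mk_eq_zero_of_eventually h
  rw [map_sub, mk_mul, mk_mul, sub_eq_zero] at this
  exact this.symm

variable {D : NonUnitalStarSubalgebra ℂ A}

/-- Uniform property Γ, with a countable set of elements of `A^U` to commute with and a countable
set of elements of `κ(D^U)` whose traces are to be divided. -/
lemma HasUniformGamma.exists_projections (hΓ : HasUniformGamma U D) (hD : IsClosed (D : Set A))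
    (hT : (traceSpace A).Nonempty) (hU : (U : Filter ℕ) ≤ cofinite)
    {C E : Set (TracialUltrapower A U)} (hC : C.Countable) (hE : E.Countable)
    (hED : E ⊆ kappa U D) {k : ℕ} (hk : 0 < k) :
    ∃ q : Fin k → TracialUltrapower A U,
      (∀ i, IsStarProjection (q i) ∧ q i ∈ kappa U D ∧ q i ∈ C.centralizer) ∧
      (∀ i j, i ≠ j → q i * q j = 0) ∧
      ∀ φ ∈ limitTraces A U, ∀ x ∈ E, ∀ i, φ (q i * x) = (1 / (k : ℂ)) * φ x := by
  classical
  obtain ⟨q, hq, hqm, hqt⟩ := hΓ.2 k hk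
  have hlift : ∀ i, ∃ d : ℕ → SAContraction D, mk A U (SAContraction.seq d) = q i := fun i =>
    exists_saContraction_lift hD (hqm i).1 (hq.1 i).nonneg (hq.1 i).norm_le
  choose d hd using hlift
  have : Countable C := hC.to_subtype
  have : Countable E := hE.to_subtype
  choose c hc using fun x : C => mk_surjective (x : TracialUltrapower A U)
  choose e heD he using fun x : E => hED x.2
  let const : A → BddSeq A := fun a => bddSeq (fun _ => a) ‖a‖ fun _ => le_rfl
  have hconst : ∀ a, mk A U (const a) = constSeq U a := fun a => rfl
  let G : (Fin k × Fin k) ⊕ (C × Fin k) → ℕ → (Fin k → SAContraction D) → A :=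
    Sum.elim (fun p _ x => (x p.1).1 * (x p.2).1 - if p.1 = p.2 then (x p.1).1 else 0)
      fun p n x => (x p.2).1 * c p.1 n - c p.1 n * (x p.2).1
  have hG1 : ∀ i n x, G (Sum.inl (i, i)) n x = (x i).1 * (x i).1 - (x i).1 := fun i n x => by
    simp [G]
  have hG2 : ∀ i j, i ≠ j → ∀ n x, G (Sum.inl (i, j)) n x = (x i).1 * (x j).1 :=
    fun i j hij n x => by simp [G, hij]
  obtain ⟨x, hx1, hx2⟩ := exists_seq_tracial (X := Fin k → SAContraction D) hU G
    (fun (p : E × Fin k) n x => (x p.2).1 * e p.1 n - (1 / (k : ℂ)) • e p.1 n)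
    -- Reindexing: with n fixed, the entries `c y n` and `e y n` are constants in A and D, where
    -- property Γ applies directly. Some coordinate l of its projections then meets the finitely
    -- many conditions, and serves as the candidate at coordinate n.
    (fun _ z => ‖z‖) fun ε hε s t => Eventually.of_forall fun n => by
      have h1 : ∀ p ∈ s, ∀ᶠ l in U, tracialNorm (G p n fun i => d i l) < ε := by
        rintro (⟨i, j⟩ | ⟨y, i⟩) -
        · by_cases hij : i = j
          · subst hij
            simp only [hG1]
            exact eventually_tracialNorm_lt_of_mk_eq_zero (U := U)
              (a := SAContraction.seq (d i) * SAContraction.seq (d i) - SAContraction.seq (d i))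
              (by rw [map_sub, mk_mul, hd, (hq.1 i).isIdempotentElem.eq, sub_self]) hε
          · simp only [hG2 i j hij]
            exact eventually_tracialNorm_lt_of_mk_eq_zero (U := U)
              (a := SAContraction.seq (d i) * SAContraction.seq (d j))
              (by rw [mk_mul, hd, hd, hq.mul_eq_zero hij]) hε
        · exact eventually_tracialNorm_lt_of_mk_eq_zero (U := U)
            (a := SAContraction.seq (d i) * const (c y n) - const (c y n) * SAContraction.seq (d i))
            (by rw [map_sub, mk_mul, mk_mul, hd, hconst,
              (hqm i).2 _ (Set.mem_range_self (c y n)), sub_self]) hε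
      have h2 : ∀ p ∈ t, ∀ᶠ l in U, ∀ τ ∈ traceSpace A,
          ‖(τ : WeakDual ℂ A) ((d p.2 l).1 * e p.1 n - (1 / (k : ℂ)) • e p.1 n)‖ < ε := by
        rintro ⟨y, i⟩ -
        refine eventually_forall_trace_lt hT (F := fun z => ‖z‖) continuous_norm (c := 0)
          (a := SAContraction.seq (d i) * const (e y n) - (1 / (k : ℂ)) • const (e y n))
          (fun φ hφ => ?_) hε
        rw [map_sub, mk_mul, hd, map_smul, hconst, map_sub, hqt φ hφ _ (heD y n), map_smul,
          smul_eq_mul, sub_self, norm_zero]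
      obtain ⟨l, hl1, hl2⟩ := (((Finset.eventually_all s).mpr h1).and
        ((Finset.eventually_all t).mpr h2)).exists
      exact ⟨fun i => d i l, hl1, hl2⟩
  let X : Fin k → BddSeq A := fun i => SAContraction.seq fun n => x n i
  have hidem : ∀ i, mk A U (X i) * mk A U (X i) = mk A U (X i) := fun i => by
    have : mk A U (X i * X i - X i) = 0 :=
      mk_eq_zero_of_eventually fun ε hε =>
        (hx1 (Sum.inl (i, i)) ε hε).mono fun n hn => by rwa [hG1] at hn
    rwa [map_sub, mk_mul, sub_eq_zero] at this
  refine ⟨fun i => mk A U (X i), fun i => ⟨⟨hidem i, SAContraction.star_mk_seq _⟩,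
    SAContraction.mk_seq_mem _, fun y hy => ?_⟩, fun i j hij => ?_, fun φ hφ y hy i => ?_⟩
  · have := mem_centralizer_of_eventually (U := U) (a := X i) (c := c ⟨y, hy⟩)
      (hx1 (Sum.inr (⟨y, hy⟩, i)))
    rwa [hc] at this
  · have : mk A U (X i * X j) = 0 :=
      mk_eq_zero_of_eventually fun ε hε =>
        (hx1 (Sum.inl (i, j)) ε hε).mono fun n hn => by rwa [hG2 i j hij] at hn
    rwa [mk_mul] at this
  · have := limitTrace_le_of_eventually hφ (F := fun z => ‖z‖) continuous_norm
      (a := X i * e ⟨y, hy⟩ - (1 / (k : ℂ)) • e ⟨y, hy⟩) (hx2 (⟨y, hy⟩, i))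
    have h0 := norm_le_zero_iff.mp this
    have hey : mk A U (e ⟨y, hy⟩) = y := he ⟨y, hy⟩
    rwa [map_sub, mk_mul, map_smul, hey, map_sub, map_smul, sub_eq_zero, smul_eq_mul] at h0

end GammaSaturation

end TracialCStar

namespace TracialCStar

open TracialUltrapower

/-! ### Tracial projectionisation. -/

section Projectionization

/-- For self-adjoint b, the condition b - b² ≥ 0 encodes being a positive contraction. It passes to
g = 2b - b² and h = b²: with s = b - b², one has g - g² = (1-b)(b+s)(1-b) and h - h² = b(2s +
(1-b)²)b. -/
lemma nonneg_sub_mul_self_of_identity {R : Type*} [NonUnitalRing R] [PartialOrder R] [StarRing R]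
    [StarOrderedRing R] {u b : R} (hu : IsIdentity u) (hb : star b = b) (hs : 0 ≤ b - b * b) :
    0 ≤ (b + (b - b * b)) - (b + (b - b * b)) * (b + (b - b * b)) ∧
      0 ≤ b * b - b * b * (b * b) := by
  have hbb : 0 ≤ b * b := by simpa [hb] using star_mul_self_nonneg b
  have hus : IsSelfAdjoint (u - b) := hu.isStarProjection.isSelfAdjoint.sub hb
  have hb0 : 0 ≤ b := by simpa using add_nonneg hs hbb
  have hub : 0 ≤ (u - b) * (u - b) := by
    simpa [hus.star_eq] using star_mul_self_nonneg (u - b)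
  constructor
  · have h := hus.conjugate_nonneg (add_nonneg hb0 hs)
    convert h using 1
    simp only [mul_sub, sub_mul, mul_add, add_mul, (hu _).1, (hu _).2, mul_assoc]
    abel
  · have h := IsSelfAdjoint.conjugate_nonneg (add_nonneg (add_nonneg hs hs) hub) (c := b) hb
    convert h using 1
    simp only [mul_sub, sub_mul, mul_add, add_mul, (hu _).1, (hu _).2, mul_assoc]
    abel

/-- This makes the averaging step gain: the defects of g and h together equal 2(s - s²), where s is
the defect of b, while g + h = 2b. -/
lemma add_sub_mul_self_identity {R : Type*} [NonUnitalRing R] (b : R) :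
    ((b + (b - b * b)) - (b + (b - b * b)) * (b + (b - b * b))) + (b * b - b * b * (b * b)) =
      ((b - b * b) - (b - b * b) * (b - b * b)) + ((b - b * b) - (b - b * b) * (b - b * b)) := by
  simp only [mul_sub, sub_mul, mul_add, add_mul, mul_assoc]
  abel

lemma sub_mul_self_nonneg_of_contraction {B : Type*} [NonUnitalCStarAlgebra B] [PartialOrder B]
    [StarOrderedRing B] {b : B} (h0 : 0 ≤ b) (h1 : ‖b‖ ≤ 1) : 0 ≤ b - b * b := by
  have hb : IsSelfAdjoint b := .of_nonneg h0
  have h : cfcₙ (fun t : ℝ => t - t * t) b = b - b * b := by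
    rw [cfcₙ_sub (fun t : ℝ => t) (fun t => t * t) b, cfcₙ_mul (fun t : ℝ => t) (fun t => t) b,
      cfcₙ_id' ℝ b]
  rw [← h]
  refine cfcₙ_nonneg fun t ht => ?_
  have ht0 : 0 ≤ t := quasispectrum_nonneg_of_nonneg _ h0 t ht
  have ht1 : t ≤ 1 := (le_abs_self t).trans
    ((NonUnitalIsometricContinuousFunctionalCalculus.norm_quasispectrum_le (𝕜 := ℝ) b ht hb).trans
      h1)
  nlinarith

/-- Here b = (b - b²) + b² is a sum of positives, and b² ≤ b gives ‖b‖² ≤ ‖b‖. -/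
lemma nonneg_and_norm_le_one_of_sub_mul_self_nonneg {B : Type*} [NonUnitalCStarAlgebra B]
    [PartialOrder B] [StarOrderedRing B] {b : B} (hb : star b = b) (hs : 0 ≤ b - b * b) :
    0 ≤ b ∧ ‖b‖ ≤ 1 := by
  have hbb : 0 ≤ b * b := by simpa [hb] using star_mul_self_nonneg b
  refine ⟨by simpa using add_nonneg hs hbb, ?_⟩
  have h1 := CStarAlgebra.norm_le_norm_of_nonneg_of_le hbb (sub_nonneg.mp hs)
  have h2 : ‖b * b‖ = ‖b‖ * ‖b‖ := by
    conv_lhs => rw [← hb]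
    rw [hb, ← CStarRing.norm_star_mul_self, hb]
  rw [h2] at h1
  nlinarith [norm_nonneg b]

variable {A : Type*} [NonUnitalCStarAlgebra A] {U : Ultrafilter ℕ}
  {D : NonUnitalStarSubalgebra ℂ A}

lemma re_limitTrace_sq_le {φ : TracialUltrapower A U →ₗ[ℂ] ℂ} (hφ : φ ∈ limitTraces A U)
    {x : TracialUltrapower A U} (hx : star x = x) : (φ x).re ^ 2 ≤ (φ (x * x)).re := by
  have h := norm_limitTrace_sq_le hφ x
  rw [hx] at h
  refine le_trans ?_ h
  rw [← sq_abs]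
  exact pow_le_pow_left₀ (abs_nonneg _) (Complex.abs_re_le_norm _) 2

/-- Positive contractions in `κ(D^U)` can be replaced by positive contractions with the same traces
against a countable set that are arbitrarily close to projections in the tracial sense. -/
lemma HasUniformGamma.exists_almost_projection (hΓ : HasUniformGamma U D)
    (hD : IsClosed (D : Set A)) (hT : (traceSpace A).Nonempty) (hU : (U : Filter ℕ) ≤ cofinite)
    {C E : Set (TracialUltrapower A U)} (hC : C.Countable) (hE : E.Countable)
    (hED : E ⊆ kappa U D) {b : TracialUltrapower A U} (hbD : b ∈ kappa U D)
    (hbC : b ∈ C.centralizer) (hb : star b = b) (hs : 0 ≤ b - b * b) (N : ℕ) :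
    ∃ c ∈ kappa U D, c ∈ C.centralizer ∧ star c = c ∧ 0 ≤ c - c * c ∧
      (∀ φ ∈ limitTraces A U, ∀ x ∈ E, φ (c * x) = φ (b * x)) ∧
      ∀ φ ∈ limitTraces A U, (φ (c - c * c)).re ≤ 1 / ((N : ℝ) + 2) := by
  induction N with
  | zero =>
    refine ⟨b, hbD, hbC, hb, hs, fun _ _ _ _ => rfl, fun φ hφ => ?_⟩
    -- With x = φ(b), the defect has trace at most x - x² ≤ 1/4.
    have h := re_limitTrace_sq_le hφ hb
    rw [map_sub, Complex.sub_re]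
    norm_num
    nlinarith [sq_nonneg ((φ b).re - 1 / 2)]
  | succ N ih =>
    obtain ⟨u, -, hu⟩ := hΓ.1
    obtain ⟨c, hcD, hcC, hc, hcs, hct, hcN⟩ := ih
    set s := c - c * c with hsdef
    obtain ⟨hg0, hh0⟩ := nonneg_sub_mul_self_of_identity hu hc hcs
    have hsum := add_sub_mul_self_identity c
    rw [← hsdef] at hg0 hsum
    have hhs : star (c * c) = c * c := by rw [star_mul, hc]
    have hgh : (c + s) + c * c = c + c := by rw [hsdef]; abel
    have hgs : star (c + s) = c + s := by rw [star_add, hc, hsdef, star_sub, hc, hhs]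
    have hhD : c * c ∈ kappa U D := mul_mem hcD hcD
    have hgD : c + s ∈ kappa U D := add_mem hcD (sub_mem hcD hhD)
    have hcomm : ∀ q, Commute q c → Commute q (c + s) ∧ Commute q (c * c) := fun q hq =>
      ⟨hq.add_right (hq.sub_right (hq.mul_right hq)), hq.mul_right hq⟩
    have hCgh : ∀ y ∈ C, Commute y (c + s) ∧ Commute y (c * c) := fun y hy => hcomm y (hcC y hy)
    generalize c + s = g at *
    generalize c * c = h at *
    -- The new element is q₀g + q₁h with q₀, q₁ orthogonal of trace one half. It has the traces of
    -- (g + h)/2 = c against E, and its defect splits as q₀(g - g²) + q₁(h - h²), of trace φ(s) -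
    -- φ(s²). Including c in the commuting set makes the q_i commute with g and h.
    obtain ⟨q, hq, hqo, hqt⟩ := hΓ.exists_projections hD hT hU (C := insert c C)
      (E := {g - g * g, h - h * h} ∪ ((g * ·) '' E ∪ (h * ·) '' E)) (hC.insert c)
      ((Set.countable_insert.mpr (Set.countable_singleton _)).union
        ((hE.image _).union (hE.image _))) (by
          rintro y ((rfl | rfl) | ⟨x, hx, rfl⟩ | ⟨x, hx, rfl⟩)
          · exact sub_mem hgD (mul_mem hgD hgD)
          · exact sub_mem hhD (mul_mem hhD hhD)
          · exact mul_mem hgD (hED hx)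
          · exact mul_mem hhD (hED hx)) (k := 2) two_pos
    have hqc : ∀ i, Commute (q i) g ∧ Commute (q i) h := fun i =>
      hcomm _ ((hq i).2.2 c (Set.mem_insert _ _)).symm
    have hqi : ∀ i, q i * q i = q i := fun i => (hq i).1.isIdempotentElem
    have hqs : ∀ i, star (q i) = q i := fun i => (hq i).1.isSelfAdjoint
    have e1 : q 0 * g * (q 0 * g) = q 0 * (g * g) := by
      rw [(hqc 0).1.symm.mul_mul_mul_comm, hqi]
    have e2 : q 1 * h * (q 1 * h) = q 1 * (h * h) := by
      rw [(hqc 1).2.symm.mul_mul_mul_comm, hqi]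
    have e3 : q 0 * g * (q 1 * h) = 0 := by
      rw [(hqc 1).1.symm.mul_mul_mul_comm, hqo 0 1 (by decide), zero_mul]
    have e4 : q 1 * h * (q 0 * g) = 0 := by
      rw [(hqc 0).2.symm.mul_mul_mul_comm, hqo 1 0 (by decide), zero_mul]
    have hdef : (q 0 * g + q 1 * h) - (q 0 * g + q 1 * h) * (q 0 * g + q 1 * h) =
        q 0 * (g - g * g) + q 1 * (h - h * h) := by
      simp only [mul_add, add_mul, e1, e2, e3, e4, mul_sub]
      abel
    have hpos : ∀ i y, Commute (q i) y → 0 ≤ y → 0 ≤ q i * y := fun i y hy h0 => by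
      have := (hq i).1.isSelfAdjoint.conjugate_nonneg h0
      rwa [mul_assoc, ← hy.eq, ← mul_assoc, hqi] at this
    refine ⟨q 0 * g + q 1 * h, add_mem (mul_mem (hq 0).2.1 hgD) (mul_mem (hq 1).2.1 hhD), ?_, ?_, ?_,
      ?_, ?_⟩
    · intro y hy
      have h1 : ∀ i, Commute y (q i) := fun i => (hq i).2.2 y (Set.mem_insert_of_mem _ hy)
      exact ((h1 0).mul_right (hCgh y hy).1).add_right ((h1 1).mul_right (hCgh y hy).2)
    · rw [star_add, star_mul, star_mul, hqs, hqs, hgs, hhs, (hqc 0).1.eq, (hqc 1).2.eq]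
    · rw [hdef]
      exact add_nonneg
        (hpos 0 _ ((hqc 0).1.sub_right ((hqc 0).1.mul_right (hqc 0).1)) hg0)
        (hpos 1 _ ((hqc 1).2.sub_right ((hqc 1).2.mul_right (hqc 1).2)) hh0)
    · intro φ hφ x hx
      rw [← hct φ hφ x hx, add_mul, mul_assoc, mul_assoc, map_add,
        hqt φ hφ _ (Or.inr (Or.inl ⟨x, hx, rfl⟩)), hqt φ hφ _ (Or.inr (Or.inr ⟨x, hx, rfl⟩)),
        ← mul_add, ← map_add, ← add_mul, hgh, add_mul, map_add]
      push_cast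
      ring
    · intro φ hφ
      have hss : star s = s := by rw [hsdef, star_sub, hc, hhs]
      have h1 : φ (q 0 * (g - g * g) + q 1 * (h - h * h)) = φ s - φ (s * s) := by
        rw [map_add, hqt φ hφ _ (Or.inl (Or.inl rfl)), hqt φ hφ _ (Or.inl (Or.inr rfl)),
          ← mul_add, ← map_add, hsum, map_add, map_sub]
        push_cast
        ring
      rw [hdef, h1, Complex.sub_re]
      have h2 := re_limitTrace_sq_le hφ hss
      have h3 := hcN φ hφ
      have h4 : 0 ≤ (φ s).re := (Complex.le_def.mp (limitTrace_nonneg hφ hcs)).1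
      have hN : (0 : ℝ) ≤ N := N.cast_nonneg
      have h5 : 1 / ((N : ℝ) + 2) ≤ 1 / 2 := by
        apply one_div_le_one_div_of_le <;> linarith
      -- The trace of the defect passes from x to at most x - x², which is increasing on [0, 1/2];
      -- this explains the rate 1/(N+2).
      have h6 : 1 / ((N : ℝ) + 2) - (1 / ((N : ℝ) + 2)) ^ 2 ≤ 1 / ((N + 1 : ℕ) + 2 : ℝ) := by
        push_cast
        rw [div_pow, div_sub_div _ _ (by positivity) (by positivity),
          div_le_div_iff₀ (by positivity) (by positivity)]
        nlinarith
      nlinarith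

/-- Tracial projectionisation: positive contractions in `κ(D^U)` can be replaced by projections with
the same traces against a countable set. -/
lemma HasUniformGamma.exists_projection (hΓ : HasUniformGamma U D)
    (hD : IsClosed (D : Set A)) (hT : (traceSpace A).Nonempty) (hU : (U : Filter ℕ) ≤ cofinite)
    {C E : Set (TracialUltrapower A U)} (hC : C.Countable) (hE : E.Countable)
    (hED : E ⊆ kappa U D) {b : TracialUltrapower A U} (hbD : b ∈ kappa U D)
    (hbC : b ∈ C.centralizer) (hb0 : 0 ≤ b) (hb1 : ‖b‖ ≤ 1) :
    ∃ p ∈ kappa U D, p ∈ C.centralizer ∧ IsStarProjection p ∧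
      ∀ φ ∈ limitTraces A U, ∀ x ∈ E, φ (p * x) = φ (b * x) := by
  have : Countable C := hC.to_subtype
  have : Countable E := hE.to_subtype
  choose c hc using fun x : C => mk_surjective (x : TracialUltrapower A U)
  choose e he using fun x : E => mk_surjective (x : TracialUltrapower A U)
  obtain ⟨b', rfl⟩ := mk_surjective b
  obtain ⟨u, -, hu⟩ := hΓ.1
  let G : Option C → ℕ → SAContraction D → A := fun o n x =>
    o.elim (x.1 * x.1 - x.1) fun y => x.1 * c y n - c y n * x.1
  obtain ⟨x, hx1, hx2⟩ := exists_seq_tracial (X := SAContraction D) hU G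
    (fun (y : E) n x => x.1 * e y n - b' n * e y n) (fun _ z => ‖z‖) fun ε hε s t => by
      -- The tolerance is ε² because the square of the 2-norm of the defect s is φ(s²) ≤ φ(s).
      obtain ⟨N, hN⟩ := exists_nat_one_div_lt (pow_pos hε 2)
      obtain ⟨d', hdD, hdC, hds, hd0, hdt, hdN⟩ := hΓ.exists_almost_projection hD hT hU hC hE hED
        hbD hbC (IsSelfAdjoint.of_nonneg hb0) (sub_mul_self_nonneg_of_contraction hb0 hb1) N
      obtain ⟨hd1, hd2⟩ := nonneg_and_norm_le_one_of_sub_mul_self_nonneg hds hd0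
      obtain ⟨d, rfl⟩ := exists_saContraction_lift hD hdD hd1 hd2
      set X := SAContraction.seq d
      have h1 : ∀ o ∈ s, ∀ᶠ n in U, tracialNorm (G o n (d n)) < ε := by
        rintro (_ | y) -
        · refine eventually_tracialNorm_lt hT (a := X * X - X) (c := 1 / ((N : ℝ) + 2)) hε
            (fun φ hφ => ?_) (lt_of_le_of_lt ?_ hN)
          · refine le_trans ?_ (hdN φ hφ)
            have h2 := (nonneg_sub_mul_self_of_identity hu hds hd0)
            have h3 := limitTrace_nonneg hφ (add_nonneg h2.1 h2.2)
            rw [add_sub_mul_self_identity, map_add, map_sub] at h3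
            have h4 := (Complex.le_def.mp h3).1
            have h5 : star (mk A U (X * X - X)) * mk A U (X * X - X) =
                (mk A U X - mk A U X * mk A U X) * (mk A U X - mk A U X * mk A U X) := by
              rw [map_sub, mk_mul, star_sub, star_mul, hds, ← neg_sub (mk A U X), neg_mul_neg]
            rw [h5]
            simp only [Complex.add_re, Complex.sub_re, Complex.zero_re] at h4
            linarith
          · gcongr
            norm_num
        · refine eventually_tracialNorm_lt_of_mk_eq_zero (a := X * c y - c y * X) ?_ hε
          rw [map_sub, mk_mul, mk_mul, hc, hdC y y.2, sub_self]
      have h2 : ∀ y ∈ t, ∀ᶠ n in U, ∀ τ ∈ traceSpace A,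
          ‖(τ : WeakDual ℂ A) ((d n).1 * e y n - b' n * e y n)‖ < ε := by
        intro y _
        refine eventually_forall_trace_lt hT (F := fun z => ‖z‖) continuous_norm (c := 0)
          (a := X * e y - b' * e y) (fun φ hφ => ?_) hε
        rw [map_sub, mk_mul, mk_mul, he, map_sub, hdt φ hφ y y.2, sub_self, norm_zero]
      filter_upwards [(Finset.eventually_all s).mpr h1, (Finset.eventually_all t).mpr h2]
        with n hn1 hn2
      exact ⟨d n, hn1, hn2⟩
  refine ⟨mk A U (SAContraction.seq x), SAContraction.mk_seq_mem _, fun y hy => ?_,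
    ⟨?_, SAContraction.star_mk_seq _⟩, fun φ hφ y hy => ?_⟩
  · have := mem_centralizer_of_eventually (U := U) (a := SAContraction.seq x) (c := c ⟨y, hy⟩)
      (hx1 (some ⟨y, hy⟩))
    rwa [hc] at this
  · have : mk A U (SAContraction.seq x * SAContraction.seq x - SAContraction.seq x) = 0 :=
      mk_eq_zero_of_eventually (hx1 none)
    rwa [map_sub, mk_mul, sub_eq_zero] at this
  · have := limitTrace_le_of_eventually hφ (F := fun z => ‖z‖) continuous_norm
      (a := SAContraction.seq x * e ⟨y, hy⟩ - b' * e ⟨y, hy⟩) (hx2 ⟨y, hy⟩)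
    have h0 := norm_le_zero_iff.mp this
    rwa [map_sub, mk_mul, mk_mul, he, map_sub, sub_eq_zero] at h0

end Projectionization

end TracialCStar

namespace TracialCStar

open TracialUltrapower

/-! ### Tracial separability and commutation. -/

section CPoU

variable {A : Type*} [NonUnitalCStarAlgebra A] {U : Ultrafilter ℕ}
  {D : NonUnitalStarSubalgebra ℂ A}

lemma isTracialSeparable_of_countable {S : Set (TracialUltrapower A U)} (hS : S.Countable) :
    IsTracialSeparable S :=
  ⟨S, subset_rfl, hS, fun x hx ε hε => ⟨x, hx, by simpa [limitNorm] using hε⟩⟩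

lemma re_limitTrace_le_limitNorm_sq {φ : TracialUltrapower A U →ₗ[ℂ] ℂ} (hφ : φ ∈ limitTraces A U)
    (x : TracialUltrapower A U) : (φ (star x * x)).re ≤ limitNorm x ^ 2 := by
  refine (Real.sqrt_le_left (Real.iSup_nonneg fun _ => Real.sqrt_nonneg _)).mp ?_
  refine le_ciSup (f := fun ψ : limitTraces A U =>
    √((ψ : TracialUltrapower A U →ₗ[ℂ] ℂ) (star x * x)).re) ⟨‖x‖, ?_⟩ ⟨φ, hφ⟩
  rintro _ ⟨ψ, rfl⟩
  rw [Real.sqrt_le_left (norm_nonneg x), sq, ← CStarRing.norm_star_mul_self]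
  exact (Complex.re_le_norm _).trans (norm_limitTrace_le ψ.2 _)

/-- The commutator with a projection is bounded in the 2-norm of a limit trace. -/
lemma re_limitTrace_commutator_le {φ : TracialUltrapower A U →ₗ[ℂ] ℂ} (hφ : φ ∈ limitTraces A U)
    {u p : TracialUltrapower A U} (hu : IsIdentity u) (hp : IsStarProjection p)
    (y : TracialUltrapower A U) :
    (φ (star (y * p - p * y) * (y * p - p * y))).re ≤ 4 * (φ (star y * y)).re := by
  have hps : star p = p := hp.isSelfAdjoint
  have hpp : p * p = p := hp.isIdempotentElem
  have hnn : ∀ x, 0 ≤ (φ (star x * x)).re := fun x =>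
    (Complex.le_def.mp (limitTrace_star_mul_self_nonneg hφ x)).1
  have hup : IsStarProjection (u - p) :=
    hp.sub_of_mul_eq_left hu.isStarProjection (hu p).2
  have h1 := hnn (y * (u - p))
  rw [star_mul, hup.isSelfAdjoint.star_eq, mul_assoc, limitTrace_mul_comm hφ, ← mul_assoc,
    mul_assoc, mul_assoc, hup.isIdempotentElem.eq, ← mul_assoc, mul_sub, (hu _).2, map_sub,
    Complex.sub_re] at h1
  have h2 := hnn ((u - p) * y)
  rw [star_mul, hup.isSelfAdjoint.star_eq, mul_assoc, ← mul_assoc (u - p),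
    hup.isIdempotentElem.eq, sub_mul, mul_sub, (hu _).1, map_sub, Complex.sub_re] at h2
  have h3 : φ (star (y * p) * (y * p)) = φ (star y * y * p) := by
    rw [star_mul, hps, mul_assoc, limitTrace_mul_comm hφ]
    simp only [mul_assoc, hpp]
  have h4 : φ (star (p * y) * (p * y)) = φ (star y * (p * y)) := by
    rw [star_mul, hps, mul_assoc, ← mul_assoc p, hpp]
  -- Parallelogram identity for yp and py, each of which has 2-norm at most that of y. For yp this
  -- uses the trace property.
  have h5 := hnn (y * p + p * y)
  have h6 : star (y * p - p * y) * (y * p - p * y) + star (y * p + p * y) * (y * p + p * y) =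
      (star (y * p) * (y * p) + star (y * p) * (y * p)) +
        (star (p * y) * (p * y) + star (p * y) * (p * y)) := by
    simp only [star_add, star_sub, add_mul, mul_add, sub_mul, mul_sub]
    abel
  have h7 := congrArg (fun z => (φ z).re) h6
  simp only [map_add, Complex.add_re, h3, h4] at h7
  linarith

/-- A projection that commutes with a dense subset, in the sense of the tracial 2-norm, commutes
with the whole set. -/
lemma mem_centralizer_of_tracially_dense (hT : (traceSpace A).Nonempty)
    {C S : Set (TracialUltrapower A U)}
    (hCS : ∀ x ∈ S, ∀ ε : ℝ, 0 < ε → ∃ c ∈ C, limitNorm (x - c) < ε)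
    {u p : TracialUltrapower A U} (hu : IsIdentity u) (hp : IsStarProjection p)
    (hpC : p ∈ C.centralizer) : p ∈ S.centralizer := by
  intro x hx
  rw [← sub_eq_zero]
  refine eq_zero_of_forall_limitTrace hT fun φ hφ => le_of_forall_pos_le_add fun ε hε => ?_
  obtain ⟨c, hc, hxc⟩ := hCS x hx (√(ε / 4)) (by positivity)
  -- Since p commutes with c, only the small element x - c enters the commutator; the choice ε/4
  -- absorbs the factor 4 in the bound.
  have h1 : x * p - p * x = (x - c) * p - p * (x - c) := by
    rw [sub_mul, mul_sub, hpC c hc]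
    abel
  rw [h1]
  have h2 := re_limitTrace_commutator_le hφ hu hp (x - c)
  have h3 := re_limitTrace_le_limitNorm_sq hφ (x - c)
  have h4 : limitNorm (x - c) ^ 2 ≤ ε / 4 := by
    rw [← Real.sq_sqrt (show 0 ≤ ε / 4 by positivity)]
    exact pow_le_pow_left₀ (Real.iSup_nonneg fun _ => Real.sqrt_nonneg _) hxc.le 2
  linarith

lemma continuous_constSeq : Continuous (constSeq U : A → TracialUltrapower A U) := by
  have h1 : ∀ a b : A, ‖constSeq U a - constSeq U b‖ ≤ ‖a - b‖ := fun a b => by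
    have : constSeq U a - constSeq U b =
        mk A U (bddSeq (fun _ => a - b) ‖a - b‖ fun _ => le_rfl) :=
      (map_sub (mk A U) _ _).symm
    rw [this]
    exact (norm_mk_le _).trans (lp.norm_le_of_forall_le (norm_nonneg _) fun _ => le_rfl)
  exact LipschitzWith.continuous (K := 1)
    (LipschitzWith.of_dist_le_mul fun a b => by simpa [dist_eq_norm] using h1 a b)

/-- Commuting with a fixed y is a closed condition, so for separable A countably many constants
enforce commutation with all of A. -/
lemma centralizer_denseRange_constSeq {ι : Type*} {f : ι → A} (hf : DenseRange f) :
    (constSeq U '' Set.range f).centralizer ⊆ (Set.range (constSeq U)).centralizer := by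
  rintro y hy _ ⟨a, rfl⟩
  have hcl : IsClosed {a : A | constSeq U a * y = y * constSeq U a} :=
    isClosed_eq (continuous_constSeq.mul continuous_const) (continuous_const.mul continuous_constSeq)
  have : closure (Set.range f) ⊆ {a : A | constSeq U a * y = y * constSeq U a} :=
    hcl.closure_subset_iff.mpr fun b hb => hy _ (Set.mem_image_of_mem _ hb)
  exact this (hf a)

/-! ### Partial partitions and their enlargement. -/

variable (D) in
/-- Orthogonal projections in `κ(D^U) ∩ C'` that satisfy the trace estimates in the definition of
CPoU, and whose sum has trace `α` everywhere. -/
structure IsPartialCPoU {k : ℕ} (C : Set (TracialUltrapower A U)) (a : Fin k → A) (δ α : ℝ)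
    (p : Fin k → TracialUltrapower A U) : Prop where
  isStarProjection : ∀ i, IsStarProjection (p i)
  mem_kappa : ∀ i, p i ∈ kappa U D
  mem_centralizer : ∀ i, p i ∈ C.centralizer
  mul_eq_zero : ∀ i j, i ≠ j → p i * p j = 0
  re_le : ∀ φ ∈ limitTraces A U, ∀ i, (φ (constSeq U (a i) * p i)).re ≤ δ * (φ (p i)).re
  trace_sum : ∀ φ ∈ limitTraces A U, φ (∑ i, p i) = α

lemma isStarProjection_sum {R ι : Type*} [NonUnitalRing R] [StarRing R] [Fintype ι] {p : ι → R}
    (hp : ∀ i, IsStarProjection (p i)) (ho : ∀ i j, i ≠ j → p i * p j = 0) :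
    IsStarProjection (∑ i, p i) := by
  classical
  refine ⟨?_, isSelfAdjoint_sum _ fun i _ => (hp i).isSelfAdjoint⟩
  rw [IsIdempotentElem, Finset.sum_mul_sum]
  refine Finset.sum_congr rfl fun i _ => ?_
  rw [Finset.sum_eq_single i (fun j _ hj => ho i j hj.symm) (by simp), (hp i).isIdempotentElem.eq]

/-- With weak CPoU and uniform property Γ, a partial CPoU can be enlarged by a definite proportion
of what is missing. -/
lemma IsPartialCPoU.exists_enlarge [PartialOrder A]
    (hweak : HasWeakCPoU U D) (hΓ : HasUniformGamma U D) (hD : IsClosed (D : Set A))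
    (hT : (traceSpace A).Nonempty) (hU : (U : Filter ℕ) ≤ cofinite)
    {C : Set (TracialUltrapower A U)} (hC : C.Countable)
    (hCA : C.centralizer ⊆ (Set.range (constSeq U)).centralizer)
    {k : ℕ} (hk : 0 < k) {a : Fin k → A} (ha : ∀ i, a i ∈ D ∧ 0 ≤ a i) {δ : ℝ} (hδ : 0 < δ)
    (haδ : (⨆ τ : traceSpace A, ⨅ i, ((τ : WeakDual ℂ A) (a i)).re) < δ)
    {α : ℝ} (hα : α < 1) {p : Fin k → TracialUltrapower A U} (hp : IsPartialCPoU D C a δ α p) :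
    ∃ p' : Fin k → TracialUltrapower A U, IsPartialCPoU D C a δ (α + (1 - α) / k) p' := by
  obtain ⟨u, huD, hu⟩ := hweak.1
  have huc : ∀ x, Commute x u := fun x => (hu x).2.trans (hu x).1.symm
  set P := ∑ i, p i with hP
  have hPp : IsStarProjection P := isStarProjection_sum hp.isStarProjection hp.mul_eq_zero
  obtain ⟨q, hqdef⟩ : ∃ q, q = u - P := ⟨_, rfl⟩
  have hq : IsStarProjection q := by
    rw [hqdef]
    exact hPp.sub_of_mul_eq_left hu.isStarProjection (hu P).2
  have hqcomm : ∀ y, (∀ i, Commute y (p i)) → Commute y q := fun y hy => by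
    rw [hqdef]
    exact (huc y).sub_right (Commute.sum_right _ _ _ fun i _ => hy i)
  have hqC : q ∈ C.centralizer := fun y hy => hqcomm y fun i => hp.mem_centralizer i y hy
  have hqD : q ∈ kappa U D := by
    rw [hqdef]
    exact sub_mem huD (sum_mem fun i _ => hp.mem_kappa i)
  have hpq : ∀ i, p i * q = 0 := fun i => by
    rw [hqdef, mul_sub, (hu _).2, hP, Finset.mul_sum,
      Finset.sum_eq_single i (fun j _ hj => hp.mul_eq_zero i j hj.symm) (by simp),
      (hp.isStarProjection i).isIdempotentElem.eq, sub_self]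
  -- The sum has the same trace α everywhere, so q has strictly positive trace everywhere, as weak
  -- CPoU demands of its weight.
  have hφq : ∀ φ ∈ limitTraces A U, φ q = ((1 - α : ℝ) : ℂ) := fun φ hφ => by
    rw [hqdef, map_sub, limitTrace_identity hU hφ hu, hp.trace_sum φ hφ]
    push_cast
    rfl
  -- Commutation with the p_i lets the e_i, and later the r_i, commute with q.
  obtain ⟨e, he, hesum, het⟩ := hweak.2 (C ∪ Set.range p)
    (isTracialSeparable_of_countable (hC.union (Set.countable_range p))) k hk a ha δ hδ haδ q
    ⟨hqD, hCA hqC⟩ hq.nonneg hq.norm_le fun φ hφ => by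
      rw [hφq φ hφ, Complex.ofReal_re]
      linarith
  have hr : ∀ i, ∃ r ∈ kappa U D, r ∈ (C ∪ Set.range p).centralizer ∧ IsStarProjection r ∧
      ∀ φ ∈ limitTraces A U, ∀ x ∈ insert q (Set.range fun i => q * constSeq U (a i)),
        φ (r * x) = φ (e i * x) := fun i =>
    hΓ.exists_projection hD hT hU (hC.union (Set.countable_range p))
      ((Set.countable_range _).insert q) (by
        rintro x (rfl | ⟨j, rfl⟩)
        · exact hqD
        · exact mul_mem hqD (constSeq_mem_kappa (ha j).1))
      (he i).2.2.1 (he i).2.2.2 (he i).1 (he i).2.1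
  choose r hrD hrC hr hrt using hr
  -- The r_i need not be orthogonal to one another. Multiplying by the orthogonal g_i enforces this
  -- and scales the traces of r_i q and r_i q a_i by exactly 1/k, so the estimates survive.
  obtain ⟨g, hg, hgo, hgt⟩ := hΓ.exists_projections hD hT hU
    (C := C ∪ Set.range p ∪ Set.range r)
    (E := (Set.range fun i => r i * q) ∪ Set.range fun i => r i * (q * constSeq U (a i)))
    ((hC.union (Set.countable_range p)).union (Set.countable_range r))
    ((Set.countable_range _).union (Set.countable_range _)) (by
      rintro x (⟨i, rfl⟩ | ⟨i, rfl⟩)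
      · exact mul_mem (hrD i) hqD
      · exact mul_mem (hrD i) (mul_mem hqD (constSeq_mem_kappa (ha i).1))) hk
  have hgp : ∀ i j, Commute (g i) (p j) := fun i j =>
    ((hg i).2.2 (p j) (Or.inl (Or.inr ⟨j, rfl⟩))).symm
  have hgr : ∀ i j, Commute (g i) (r j) := fun i j =>
    ((hg i).2.2 (r j) (Or.inr ⟨j, rfl⟩)).symm
  have hrp : ∀ i j, Commute (r i) (p j) := fun i j => (hrC i (p j) (Or.inr ⟨j, rfl⟩)).symm
  have hgq : ∀ i, Commute (g i) q := fun i => hqcomm _ (hgp i)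
  have hrq : ∀ i, Commute (r i) q := fun i => hqcomm _ (hrp i)
  obtain ⟨t, htdef⟩ : ∃ t : Fin k → TracialUltrapower A U, ∀ i, t i = g i * (r i * q) :=
    ⟨_, fun i => rfl⟩
  have htp : ∀ i, IsStarProjection (t i) := fun i => by
    rw [htdef]
    exact (hg i).1.mul ((hr i).mul hq (hrq i)) ((hgr i i).mul_right (hgq i))
  have hpt : ∀ i j, p i * t j = 0 := fun i j => by
    rw [htdef, ← mul_assoc, ← (hgp j i).eq, mul_assoc, ← mul_assoc (p i), ← (hrp j i).eq,
      mul_assoc (r j), hpq, mul_zero, mul_zero]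
  have htp0 : ∀ i j, t i * p j = 0 := fun i j => by
    have := congrArg star (hpt j i)
    rwa [star_mul, (htp i).isSelfAdjoint.star_eq, (hp.isStarProjection j).isSelfAdjoint.star_eq,
      star_zero] at this
  have htt : ∀ i j, i ≠ j → t i * t j = 0 := fun i j hij => by
    rw [htdef, htdef, ((hgr j i).mul_right (hgq j)).symm.mul_mul_mul_comm, hgo i j hij, zero_mul]
  have hφt : ∀ φ ∈ limitTraces A U, ∀ i, φ (t i) = (1 / (k : ℂ)) * φ (e i * q) :=
    fun φ hφ i => by
      rw [htdef, hgt φ hφ _ (Or.inl ⟨i, rfl⟩), hrt i φ hφ q (Or.inl rfl)]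
  have hφat : ∀ φ ∈ limitTraces A U, ∀ i,
      φ (constSeq U (a i) * t i) = (1 / (k : ℂ)) * φ (constSeq U (a i) * e i * q) :=
    fun φ hφ i => by
      rw [limitTrace_mul_comm hφ, htdef, mul_assoc, mul_assoc, hgt φ hφ _ (Or.inr ⟨i, rfl⟩),
        hrt i φ hφ _ (Or.inr ⟨i, rfl⟩), ← mul_assoc, limitTrace_mul_comm hφ, mul_assoc]
  have hkre : ∀ z : ℂ, (1 / (k : ℂ) * z).re = 1 / (k : ℝ) * z.re := fun z => by
    rw [← Complex.re_ofReal_mul]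
    push_cast
    rfl
  refine ⟨fun i => p i + t i, fun i => (hp.isStarProjection i).add (htp i) (hpt i i),
    fun i => add_mem (hp.mem_kappa i) ?_, fun i => Set.add_mem_centralizer (hp.mem_centralizer i) ?_,
    fun i j hij => ?_, fun φ hφ i => ?_, fun φ hφ => ?_⟩
  · rw [htdef]
    exact mul_mem (hg i).2.1 (mul_mem (hrD i) hqD)
  · rw [htdef]
    exact Set.mul_mem_centralizer (fun y hy => (hg i).2.2 y (Or.inl (Or.inl hy)))
      (Set.mul_mem_centralizer (fun y hy => hrC i y (Or.inl hy)) hqC)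
  · rw [add_mul, mul_add, mul_add, hp.mul_eq_zero i j hij, hpt, htp0, htt i j hij]
    simp
  · rw [mul_add, map_add, map_add, Complex.add_re, Complex.add_re, hφat φ hφ, hφt φ hφ, hkre, hkre,
      mul_add]
    have h1 := hp.re_le φ hφ i
    have h2 := mul_le_mul_of_nonneg_left (het φ hφ i) (show (0 : ℝ) ≤ 1 / k by positivity)
    linarith
  · rw [Finset.sum_add_distrib, map_add, hp.trace_sum φ hφ, map_sum,
      Finset.sum_congr rfl fun i _ => hφt φ hφ i, ← Finset.mul_sum, ← map_sum, ← Finset.sum_mul,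
      (hesum q).1, hφq φ hφ]
    push_cast
    ring

/-- Start from zero projections and iterate: each enlargement multiplies the missing trace by 1 -
1/k. -/
lemma exists_isPartialCPoU [PartialOrder A]
    (hweak : HasWeakCPoU U D) (hΓ : HasUniformGamma U D) (hD : IsClosed (D : Set A))
    (hT : (traceSpace A).Nonempty) (hU : (U : Filter ℕ) ≤ cofinite)
    {C : Set (TracialUltrapower A U)} (hC : C.Countable)
    (hCA : C.centralizer ⊆ (Set.range (constSeq U)).centralizer)
    {k : ℕ} (hk : 0 < k) {a : Fin k → A} (ha : ∀ i, a i ∈ D ∧ 0 ≤ a i) {δ : ℝ} (hδ : 0 < δ)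
    (haδ : (⨆ τ : traceSpace A, ⨅ i, ((τ : WeakDual ℂ A) (a i)).re) < δ) (N : ℕ) :
    ∃ p : Fin k → TracialUltrapower A U, IsPartialCPoU D C a δ (1 - (1 - 1 / (k : ℝ)) ^ N) p := by
  induction N with
  | zero =>
    refine ⟨fun _ => 0, fun _ => .zero _, fun _ => zero_mem _, fun _ => Set.zero_mem_centralizer,
      fun _ _ _ => zero_mul _, fun φ _ _ => by simp, fun φ _ => by simp⟩
  | succ N ih =>
    obtain ⟨p, hp⟩ := ih
    have h1 : (0 : ℝ) ≤ 1 - 1 / k := by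
      rw [sub_nonneg, div_le_one (by positivity)]
      exact_mod_cast hk
    -- If no trace is missing any more, which can happen only for k = 1, the enlargement does not
    -- apply and p is kept.
    rcases (pow_nonneg h1 N).eq_or_lt with h | h
    · refine ⟨p, ?_⟩
      rwa [pow_succ, ← h, zero_mul, h]
    · have := hp.exists_enlarge hweak hΓ hD hT hU hC hCA hk ha hδ haδ (by linarith)
      convert this using 3
      ring

/-! ### Passage to the limit by saturation. -/

/-- Weak CPoU and uniform property Γ give CPoU for countable sets. -/
lemma exists_cpou_of_countable [PartialOrder A]
    (hweak : HasWeakCPoU U D) (hΓ : HasUniformGamma U D) (hD : IsClosed (D : Set A))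
    (hT : (traceSpace A).Nonempty) (hU : (U : Filter ℕ) ≤ cofinite)
    {C : Set (TracialUltrapower A U)} (hC : C.Countable)
    (hCA : C.centralizer ⊆ (Set.range (constSeq U)).centralizer)
    {k : ℕ} (hk : 0 < k) {a : Fin k → A} (ha : ∀ i, a i ∈ D ∧ 0 ≤ a i) {δ : ℝ} (hδ : 0 < δ)
    (haδ : (⨆ τ : traceSpace A, ⨅ i, ((τ : WeakDual ℂ A) (a i)).re) < δ) :
    ∃ p : Fin k → TracialUltrapower A U,
      IsProjectionPartition p ∧ (∀ i, p i ∈ kappa U D ∧ p i ∈ C.centralizer) ∧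
      ∀ φ ∈ limitTraces A U, ∀ i, (φ (constSeq U (a i) * p i)).re ≤ δ * (φ (p i)).re := by
  classical
  have : Countable C := hC.to_subtype
  choose c hc using fun x : C => mk_surjective (x : TracialUltrapower A U)
  obtain ⟨v, hvD, hv⟩ := hweak.1
  obtain ⟨v, rfl⟩ := mk_surjective v
  let const : A → BddSeq A := fun a => bddSeq (fun _ => a) ‖a‖ fun _ => le_rfl
  let G : (Fin k × Fin k) ⊕ (C × Fin k) → ℕ → (Fin k → SAContraction D) → A :=
    Sum.elim (fun p _ x => (x p.1).1 * (x p.2).1 - if p.1 = p.2 then (x p.1).1 else 0)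
      fun p n x => (x p.2).1 * c p.1 n - c p.1 n * (x p.2).1
  -- The value `none` bounds the trace of the defect from above; as the defect will be a projection,
  -- no other condition is needed to make the sum the identity.
  let L : Option (Fin k) → ℕ → (Fin k → SAContraction D) → A := fun o n x =>
    o.elim (v n - ∑ i, (x i).1) fun i => a i * (x i).1 - (δ : ℂ) • (x i).1
  have hG1 : ∀ i n x, G (Sum.inl (i, i)) n x = (x i).1 * (x i).1 - (x i).1 := fun i n x => by
    simp [G]
  have hG2 : ∀ i j, i ≠ j → ∀ n x, G (Sum.inl (i, j)) n x = (x i).1 * (x j).1 :=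
    fun i j hij n x => by simp [G, hij]
  have hsum : ∀ (d : Fin k → ℕ → SAContraction D) n,
      (v - ∑ i, SAContraction.seq (d i)) n = v n - ∑ i, (d i n).1 := fun d n => by
    rw [lp.coeFn_sub, Pi.sub_apply, lp.coeFn_sum, Finset.sum_apply]
    rfl
  obtain ⟨x, hx1, hx2⟩ := exists_seq_tracial hU G L (fun _ z => z.re) fun ε hε s t => by
    have hk1 : 1 - 1 / (k : ℝ) < 1 := sub_lt_self _ (by positivity)
    obtain ⟨N, hN⟩ := exists_pow_lt_of_lt_one hε hk1
    obtain ⟨q, hq⟩ := exists_isPartialCPoU hweak hΓ hD hT hU hC hCA hk ha hδ haδ N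
    choose d hd using fun i => exists_saContraction_lift hD (hq.mem_kappa i)
      (hq.isStarProjection i).nonneg (hq.isStarProjection i).norm_le
    have h1 : ∀ o ∈ s, ∀ᶠ n in U, tracialNorm (G o n fun i => d i n) < ε := by
      rintro (⟨i, j⟩ | ⟨y, i⟩) -
      · by_cases hij : i = j
        · subst hij
          simp only [hG1]
          exact eventually_tracialNorm_lt_of_mk_eq_zero (U := U)
            (a := SAContraction.seq (d i) * SAContraction.seq (d i) - SAContraction.seq (d i))
            (by rw [map_sub, mk_mul, hd, (hq.isStarProjection i).isIdempotentElem.eq, sub_self]) hε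
        · simp only [hG2 i j hij]
          exact eventually_tracialNorm_lt_of_mk_eq_zero (U := U)
            (a := SAContraction.seq (d i) * SAContraction.seq (d j))
            (by rw [mk_mul, hd, hd, hq.mul_eq_zero i j hij]) hε
      · exact eventually_tracialNorm_lt_of_mk_eq_zero (U := U)
          (a := SAContraction.seq (d i) * c y - c y * SAContraction.seq (d i))
          (by rw [map_sub, mk_mul, mk_mul, hd, hc, hq.mem_centralizer i y y.2, sub_self]) hε
    have h2 : ∀ o ∈ t, ∀ᶠ n in U, ∀ τ ∈ traceSpace A,
        ((τ : WeakDual ℂ A) (L o n fun i => d i n)).re < ε := by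
      rintro (_ | i) -
      · have := eventually_forall_trace_lt (U := U) hT Complex.continuous_re
          (a := v - ∑ i, SAContraction.seq (d i)) (c := (1 - 1 / (k : ℝ)) ^ N) (fun φ hφ => ?_) hN
        · simp only [hsum] at this
          exact this
        · rw [map_sub, map_sum, Finset.sum_congr rfl fun i _ => hd i, map_sub,
            limitTrace_identity hU hφ hv, hq.trace_sum φ hφ, ← Complex.ofReal_one,
            ← Complex.ofReal_sub, Complex.ofReal_re]
          linarith
      · refine eventually_forall_trace_lt hT Complex.continuous_re (c := 0)
          (a := const (a i) * SAContraction.seq (d i) - (δ : ℂ) • SAContraction.seq (d i))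
          (fun φ hφ => ?_) hε
        rw [map_sub, mk_mul, map_smul, hd, map_sub, map_smul, smul_eq_mul, Complex.sub_re,
          Complex.re_ofReal_mul, sub_nonpos]
        exact hq.re_le φ hφ i
    filter_upwards [(Finset.eventually_all s).mpr h1, (Finset.eventually_all t).mpr h2]
      with n hn1 hn2
    exact ⟨fun i => d i n, hn1, hn2⟩
  let X : Fin k → BddSeq A := fun i => SAContraction.seq fun n => x n i
  have hproj : ∀ i, IsStarProjection (mk A U (X i)) := fun i => by
    refine ⟨?_, SAContraction.star_mk_seq _⟩
    have : mk A U (X i * X i - X i) = 0 := mk_eq_zero_of_eventually fun ε hε =>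
      (hx1 (Sum.inl (i, i)) ε hε).mono fun n hn => by rwa [hG1] at hn
    rwa [map_sub, mk_mul, sub_eq_zero] at this
  have horth : ∀ i j, i ≠ j → mk A U (X i) * mk A U (X j) = 0 := fun i j hij => by
    have : mk A U (X i * X j) = 0 := mk_eq_zero_of_eventually fun ε hε =>
      (hx1 (Sum.inl (i, j)) ε hε).mono fun n hn => by rwa [hG2 i j hij] at hn
    rwa [mk_mul] at this
  refine ⟨fun i => mk A U (X i), ⟨hproj, ?_⟩, fun i => ⟨SAContraction.mk_seq_mem _, fun y hy => ?_⟩,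
    fun φ hφ i => ?_⟩
  · have hP := isStarProjection_sum hproj horth
    have hQ := hP.sub_of_mul_eq_left hv.isStarProjection (hv _).2
    -- The defect is a projection, so its 2-norm is governed by its trace, which is at most every ε.
    have : mk A U v - ∑ i, mk A U (X i) = 0 := eq_zero_of_forall_limitTrace hT fun φ hφ => by
      rw [hQ.isSelfAdjoint.star_eq, hQ.isIdempotentElem.eq, ← map_sum, ← map_sub]
      refine limitTrace_le_of_eventually hφ Complex.continuous_re fun ε hε => ?_
      refine (hx2 none ε hε).mono fun n hn => ?_
      rw [hsum]
      exact hn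
    rwa [← sub_eq_zero.mp this]
  · have := mem_centralizer_of_eventually (U := U) (a := X i) (c := c ⟨y, hy⟩)
      (hx1 (Sum.inr (⟨y, hy⟩, i)))
    rwa [hc] at this
  · have := limitTrace_le_of_eventually hφ Complex.continuous_re
      (a := const (a i) * X i - (δ : ℂ) • X i) (hx2 (some i))
    rwa [map_sub, mk_mul, map_smul, map_sub, map_smul, smul_eq_mul, Complex.sub_re,
      Complex.re_ofReal_mul, sub_nonpos] at this

end CPoU

end TracialCStar

/-! ### Reduction of separable sets to countable ones. -/

theorem proposition4p4 {A : Type*} [NonUnitalCStarAlgebra A] [PartialOrder A] [StarOrderedRing A]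
    [TopologicalSpace.SeparableSpace A]
    (D : NonUnitalStarSubalgebra ℂ A) (hD_closed : IsClosed (D : Set A)) (hD_ne : D ≠ ⊥)
    (hT_ne : (TracialCStar.traceSpace A).Nonempty)
    (hT_compact : IsCompact (TracialCStar.traceSpace A))
    (U : Ultrafilter ℕ) (hU : (U : Filter ℕ) ≤ Filter.cofinite)
    (hweak : TracialCStar.HasWeakCPoU U D) (hGamma : TracialCStar.HasUniformGamma U D) :
    TracialCStar.HasCPoU U D := by
  refine ⟨hweak.1, fun S ⟨C, _, hC, hCS⟩ k hk a ha δ hδ haδ => ?_⟩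
  obtain ⟨u, -, hu⟩ := hweak.1
  obtain ⟨p, hp, hpm, hpt⟩ := TracialCStar.exists_cpou_of_countable hweak hGamma hD_closed hT_ne hU
    -- The dense sequence of A is added because the defects used as weights must commute with A,
    -- which commutation with S alone would not ensure.
    (C := C ∪ TracialCStar.constSeq U '' Set.range (TopologicalSpace.denseSeq A))
    (hC.union ((Set.countable_range _).image _))
    ((Set.centralizer_subset Set.subset_union_right).trans
      (TracialCStar.centralizer_denseRange_constSeq (TopologicalSpace.denseRange_denseSeq A)))
    hk ha hδ haδ
  exact ⟨p, hp, fun i => ⟨(hpm i).1, TracialCStar.mem_centralizer_of_tracially_dense hT_ne hCS hu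
    (hp.1 i) (Set.centralizer_subset Set.subset_union_left (hpm i).2)⟩, hpt⟩
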